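/- Let $M$ be a compact connected complex manifold and let $(N,g)$ be a (smooth) Riemannian manifold with non-positive sectional curvature. Let $\mathbb{P}(T_M)\to M$ be the projective bundle whose points are the pairs $(p,\ell)$, where $p\in M$ and $\ell$ is a complex line in the holomorphic tangent space $T_pM$, and let $\mathcal{O}_{T^*_M}(-1)$ be the tautological holomorphic line bundle over $\mathbb{P}(T_M)$, whose fibre over $(p,\ell)$ is $\ell$. Suppose that $\mathcal{O}_{T^*_M}(-1)$ is RC-positive, that is, it admits a smooth Hermitian metric $\mathscr{H}$ whose Chern curvature $-\sqrt{-1}\,\partial\bar\partial\log\mathscr{H}$ has at least one positive eigenvalue at every point of $\mathbb{P}(T_M)$. Let $f\colon M\to N$ be a pluri-harmonic map, that is, a smooth map which satisfies, in all local holomorphic coordinates $(z^\alpha)$ on $M$ and all local coordinates $(x^i)$ on $N$, $$\frac{\partial^2 f^i}{\partial z^\alpha\,\partial\bar z^\beta}+\sum_{j,k}\Gamma^i_{jk}(f)\,\frac{\partial f^j}{\partial\bar z^\beta}\,\frac{\partial f^k}{\partial z^\alpha}=0\qquad\text{for all } \alpha,\beta,i,$$ where $\Gamma^i_{jk}$ are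 the Christoffel symbols of the Levi-Civita connection of $g$. Then $f$ is a constant map. -/

import Mathlib

open scoped Manifold ContDiff ComplexConjugate

noncomputable section

/-! ## Calculus in coordinates -/

section Coordinates

variable {ι : Type*} [Fintype ι] [DecidableEq ι]

/-- The real partial derivative `∂u/∂x^i` of a function on `ℝⁿ`. -/
def partialDeriv (i : ι) (u : EuclideanSpace ℝ ι → ℝ) (x : EuclideanSpace ℝ ι) : ℝ :=
  fderiv ℝ u x (EuclideanSpace.single i 1)

/-- The Wirtinger derivative `∂u/∂z^s = (∂u/∂x^s - i ∂u/∂y^s) / 2`, where `z^s = x^s + i y^s`. -/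
def dz (s : ι) (u : EuclideanSpace ℂ ι → ℂ) (z : EuclideanSpace ℂ ι) : ℂ :=
  (1 / 2 : ℂ) * (fderiv ℝ u z (EuclideanSpace.single s 1)
    - Complex.I * fderiv ℝ u z (EuclideanSpace.single s Complex.I))

/-- The Wirtinger derivative `∂u/∂z̄^s = (∂u/∂x^s + i ∂u/∂y^s) / 2`, where `z^s = x^s + i y^s`. -/
def dzbar (s : ι) (u : EuclideanSpace ℂ ι → ℂ) (z : EuclideanSpace ℂ ι) : ℂ :=
  (1 / 2 : ℂ) * (fderiv ℝ u z (EuclideanSpace.single s 1)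
    + Complex.I * fderiv ℝ u z (EuclideanSpace.single s Complex.I))

/-- The components `R_{s t̄} = -∂² log ρ / ∂z^s ∂z̄^t` of the Chern curvature
`-√-1 ∂∂̄ log ρ` of a Hermitian holomorphic line bundle, where `ρ` is the squared length of a
nowhere vanishing local holomorphic section, written in local holomorphic coordinates. -/
def chernCurvature (ρ : EuclideanSpace ℂ ι → ℝ) (z : EuclideanSpace ℂ ι) : Matrix ι ι ℂ :=
  Matrix.of fun s t => -dz s (dzbar t (fun y => ((Real.log (ρ y) : ℝ) : ℂ))) z

/-- The Hermitian matrix `A` has at least one positive eigenvalue. (For the matrix of a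
`(1,1)`-form this does not depend on the coordinates, by the law of inertia.) -/
def HasPositiveEigenvalue (A : Matrix ι ι ℂ) : Prop :=
  ∃ μ : ℝ, 0 < μ ∧ Module.End.HasEigenvalue (Matrix.toLin' A) (μ : ℂ)

end Coordinates

/-! ## The projective bundle `P(T_M)` and its tautological line bundle -/

section ProjectiveBundle

variable {m : ℕ} (M : Type*) [TopologicalSpace M] [ChartedSpace (EuclideanSpace ℂ (Fin m)) M]

/-- The points of the projective bundle `P(T_M)`: a point `p` of `M` and a complex line in the
holomorphic tangent space `T_pM` (equivalently, a hyperplane of `T*_pM`). -/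
def ProjTangent : Type _ :=
  Σ p : M, Projectivization ℂ (TangentSpace 𝓘(ℂ, EuclideanSpace ℂ (Fin m)) p)

variable {M}

/-- The fibre of the line bundle `𝒪_{T*_M}(-1)` over `x = (p, ℓ) ∈ P(T_M)`: the line
`ℓ ⊆ T_pM` itself. -/
def ProjTangent.tautologicalFiber (x : ProjTangent (m := m) M) :
    Submodule ℂ (TangentSpace 𝓘(ℂ, EuclideanSpace ℂ (Fin m)) x.1) :=
  x.2.submodule

/-- The projection of local coordinates `ζ = (z, w)` on `P(T_M)` to local coordinates `z`
on `M`. -/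
def baseCoord {a : Fin m} (ζ : EuclideanSpace ℂ (Fin m ⊕ {i : Fin m // i ≠ a})) :
    EuclideanSpace ℂ (Fin m) :=
  WithLp.toLp 2 fun i => ζ (Sum.inl i)

/-- The homogeneous fibre coordinates `W`, normalised by `W^a = 1`, of the point of `P(T_M)` with
local coordinates `ζ = (z, w)`: `W^i = w^i` for `i ≠ a`. -/
def fiberCoord {a : Fin m} (ζ : EuclideanSpace ℂ (Fin m ⊕ {i : Fin m // i ≠ a})) :
    EuclideanSpace ℂ (Fin m) :=
  WithLp.toLp 2 fun i => if h : i ≠ a then ζ (Sum.inr ⟨i, h⟩) else 1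

/-- The domain of the local coordinates `ζ = (z, w)` of `P(T_M)` induced by a holomorphic chart
`φ` of `M` and an index `a`. These coordinates parametrize the open subset of `P(T_M)` of all
lines in `T_pM`, `p` in the domain of `φ`, on which `dz^a` does not vanish; letting `φ` and `a`
vary one obtains the holomorphic atlas of `P(T_M)`. -/
def projChartTarget (φ : OpenPartialHomeomorph M (EuclideanSpace ℂ (Fin m))) (a : Fin m) :
    Set (EuclideanSpace ℂ (Fin m ⊕ {i : Fin m // i ≠ a})) :=
  {ζ | baseCoord ζ ∈ φ.target}

/-- The tangent vector `∑ W^i ∂/∂z^i ∈ T_pM`, `W = fiberCoord ζ`, at the point `p` of `M` with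
coordinates `z = baseCoord ζ`. It spans the line in `T_pM` with local coordinates `ζ`, and as a
function of `ζ` it is the standard nowhere vanishing local holomorphic section of
`𝒪_{T*_M}(-1)`. -/
def tautologicalSection (φ : OpenPartialHomeomorph M (EuclideanSpace ℂ (Fin m))) {a : Fin m}
    (ζ : EuclideanSpace ℂ (Fin m ⊕ {i : Fin m // i ≠ a})) :
    TangentSpace 𝓘(ℂ, EuclideanSpace ℂ (Fin m)) (φ.symm (baseCoord ζ)) :=
  mfderiv 𝓘(ℂ, EuclideanSpace ℂ (Fin m)) 𝓘(ℂ, EuclideanSpace ℂ (Fin m)) φ.symm (baseCoord ζ)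
    (fiberCoord ζ)

open Classical in
/-- For a choice of a Hermitian inner product on each line of `𝒪_{T*_M}(-1)`: the squared length
of `v ∈ T_pM`, regarded, when `v ≠ 0`, as an element of the line `[v]`. -/
def tautologicalNormSq
    (H : ∀ x : ProjTangent (m := m) M, InnerProductSpace.Core ℂ x.tautologicalFiber)
    (p : M) (v : TangentSpace 𝓘(ℂ, EuclideanSpace ℂ (Fin m)) p) : ℝ :=
  if hv : v ≠ 0 then
    let x : ProjTangent (m := m) M := ⟨p, Projectivization.mk ℂ v hv⟩
    let e : x.tautologicalFiber := ⟨v, by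
      change v ∈ (Projectivization.mk ℂ v hv).submodule
      rw [Projectivization.submodule_mk]
      exact Submodule.mem_span_singleton_self v⟩
    ((H x).inner e e).re
  else 0

variable (M)

/-- A smooth Hermitian metric on the line bundle `𝒪_{T*_M}(-1) → P(T_M)`: a Hermitian inner
product on each fibre for which the squared lengths of the standard local holomorphic sections are
smooth functions of the local coordinates of `P(T_M)`. -/
structure TautologicalHermitianMetric [IsManifold 𝓘(ℂ, EuclideanSpace ℂ (Fin m)) ω M] where
  /-- the Hermitian inner product on each fibre -/
  core : ∀ x : ProjTangent (m := m) M, InnerProductSpace.Core ℂ x.tautologicalFiber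
  smooth : ∀ φ ∈ IsManifold.maximalAtlas 𝓘(ℂ, EuclideanSpace ℂ (Fin m)) ω M, ∀ a : Fin m,
    ContDiffOn ℝ ∞ (fun ζ => tautologicalNormSq core _ (tautologicalSection φ (a := a) ζ))
      (projChartTarget φ a)

/-- The line bundle `𝒪_{T*_M}(-1)` over `P(T_M)` is RC-positive: it admits a smooth Hermitian
metric whose Chern curvature has at least one positive eigenvalue at every point of `P(T_M)`. -/
def TautologicalRCPositive [IsManifold 𝓘(ℂ, EuclideanSpace ℂ (Fin m)) ω M] : Prop :=
  ∃ H : TautologicalHermitianMetric (m := m) M,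
    ∀ φ ∈ IsManifold.maximalAtlas 𝓘(ℂ, EuclideanSpace ℂ (Fin m)) ω M, ∀ a : Fin m,
      ∀ ζ ∈ projChartTarget φ a,
        HasPositiveEigenvalue (chernCurvature
          (fun ξ => tautologicalNormSq H.core _ (tautologicalSection φ (a := a) ξ)) ζ)

end ProjectiveBundle

/-! ## Riemannian geometry in local coordinates -/

section Riemannian

variable {n : ℕ} {N : Type*} [TopologicalSpace N] [ChartedSpace (EuclideanSpace ℝ (Fin n)) N]
  [IsManifold 𝓘(ℝ, EuclideanSpace ℝ (Fin n)) ∞ N]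

/-- Smooth Riemannian metrics on `N`. -/
abbrev SmoothRiemannianMetric (N : Type*) [TopologicalSpace N]
    [ChartedSpace (EuclideanSpace ℝ (Fin n)) N]
    [IsManifold 𝓘(ℝ, EuclideanSpace ℝ (Fin n)) ∞ N] : Type _ :=
  Bundle.ContMDiffRiemannianMetric 𝓘(ℝ, EuclideanSpace ℝ (Fin n)) ∞ (EuclideanSpace ℝ (Fin n))
    (fun q : N => TangentSpace 𝓘(ℝ, EuclideanSpace ℝ (Fin n)) q)

/-- The coordinate vector field `∂/∂x^i` of the chart `ψ`, at the point with coordinates `x`. -/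
def coordVector (ψ : OpenPartialHomeomorph N (EuclideanSpace ℝ (Fin n))) (i : Fin n)
    (x : EuclideanSpace ℝ (Fin n)) :
    TangentSpace 𝓘(ℝ, EuclideanSpace ℝ (Fin n)) (ψ.symm x) :=
  mfderiv 𝓘(ℝ, EuclideanSpace ℝ (Fin n)) 𝓘(ℝ, EuclideanSpace ℝ (Fin n)) ψ.symm x
    (EuclideanSpace.single i (1 : ℝ))

/-- The matrix `g_{ij} = g(∂/∂x^i, ∂/∂x^j)` of the metric in the chart `ψ`. -/
def metricMatrix (g : SmoothRiemannianMetric (n := n) N)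
    (ψ : OpenPartialHomeomorph N (EuclideanSpace ℝ (Fin n))) (x : EuclideanSpace ℝ (Fin n)) :
    Matrix (Fin n) (Fin n) ℝ :=
  Matrix.of fun i j => g.inner (ψ.symm x) (coordVector ψ i x) (coordVector ψ j x)

/-- The Christoffel symbols
`Γ^i_{jk} = ½ ∑_l g^{il} (∂_j g_{lk} + ∂_k g_{lj} - ∂_l g_{jk})` of the Levi-Civita connection. -/
def christoffel (g : SmoothRiemannianMetric (n := n) N)
    (ψ : OpenPartialHomeomorph N (EuclideanSpace ℝ (Fin n))) (i j k : Fin n)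
    (x : EuclideanSpace ℝ (Fin n)) : ℝ :=
  (1 / 2 : ℝ) * ∑ l, (metricMatrix g ψ x)⁻¹ i l *
    (partialDeriv j (fun y => metricMatrix g ψ y l k) x
      + partialDeriv k (fun y => metricMatrix g ψ y l j) x
      - partialDeriv l (fun y => metricMatrix g ψ y j k) x)

/-- The components `R_{ijk}^l` of the curvature
`R(X, Y)Z = ∇_X ∇_Y Z - ∇_Y ∇_X Z - ∇_{[X,Y]} Z`, that is,
`R(∂_i, ∂_j) ∂_k = ∑_l R_{ijk}^l ∂_l`. -/
def curvatureUp (g : SmoothRiemannianMetric (n := n) N)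
    (ψ : OpenPartialHomeomorph N (EuclideanSpace ℝ (Fin n))) (i j k l : Fin n)
    (x : EuclideanSpace ℝ (Fin n)) : ℝ :=
  partialDeriv i (christoffel g ψ l k j) x - partialDeriv j (christoffel g ψ l k i) x
    + ∑ p, (christoffel g ψ p k j x * christoffel g ψ l p i x
      - christoffel g ψ p k i x * christoffel g ψ l p j x)

/-- The components `R_{ijkl} = g(R(∂_i, ∂_j) ∂_k, ∂_l) = ∑_s g_{sl} R_{ijk}^s`. -/
def curvatureDown (g : SmoothRiemannianMetric (n := n) N)
    (ψ : OpenPartialHomeomorph N (EuclideanSpace ℝ (Fin n))) (i j k l : Fin n)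
    (x : EuclideanSpace ℝ (Fin n)) : ℝ :=
  ∑ s, metricMatrix g ψ x s l * curvatureUp g ψ i j k s x

/-- The inner product `g(X, Y)` of `X = ∑ X^i ∂_i` and `Y = ∑ Y^j ∂_j`. -/
def metricForm (g : SmoothRiemannianMetric (n := n) N)
    (ψ : OpenPartialHomeomorph N (EuclideanSpace ℝ (Fin n))) (x : EuclideanSpace ℝ (Fin n))
    (X Y : Fin n → ℝ) : ℝ :=
  ∑ i, ∑ j, metricMatrix g ψ x i j * X i * Y j

/-- The sectional curvature
`K(X, Y) = g(R(X, Y)Y, X) / (g(X, X) g(Y, Y) - g(X, Y)²)` of the plane spanned by the linearly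
independent vectors `X = ∑ X^i ∂_i` and `Y = ∑ Y^j ∂_j`. -/
def sectionalCurvature (g : SmoothRiemannianMetric (n := n) N)
    (ψ : OpenPartialHomeomorph N (EuclideanSpace ℝ (Fin n))) (x : EuclideanSpace ℝ (Fin n))
    (X Y : Fin n → ℝ) : ℝ :=
  (∑ i, ∑ j, ∑ k, ∑ l, curvatureDown g ψ i j k l x * X i * Y j * Y k * X l) /
    (metricForm g ψ x X X * metricForm g ψ x Y Y - metricForm g ψ x X Y ^ 2)

/-- The Riemannian manifold `(N, g)` has non-positive sectional curvature. -/
def NonposSectionalCurvature (g : SmoothRiemannianMetric (n := n) N) : Prop :=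
  ∀ ψ ∈ IsManifold.maximalAtlas 𝓘(ℝ, EuclideanSpace ℝ (Fin n)) ∞ N, ∀ x ∈ ψ.target,
    ∀ X Y : Fin n → ℝ, LinearIndependent ℝ ![X, Y] → sectionalCurvature g ψ x X Y ≤ 0

/-- The smooth map `f` from the complex manifold `M` to the Riemannian manifold `(N, g)` is
pluri-harmonic: in all local holomorphic coordinates `z^α` on `M` and all local coordinates `x^i`
on `N`,
`∂²f^i/∂z^α∂z̄^β + ∑_{j,k} Γ^i_{jk}(f) ∂f^j/∂z̄^β ∂f^k/∂z^α = 0` for all `α`, `β` and `i`. -/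
structure IsPluriharmonic {m : ℕ} {M : Type*} [TopologicalSpace M]
    [ChartedSpace (EuclideanSpace ℂ (Fin m)) M]
    [IsManifold 𝓘(ℂ, EuclideanSpace ℂ (Fin m)) ω M]
    (g : SmoothRiemannianMetric (n := n) N) (f : M → N) : Prop where
  smooth : ContMDiff 𝓘(ℝ, EuclideanSpace ℂ (Fin m)) 𝓘(ℝ, EuclideanSpace ℝ (Fin n)) ∞ f
  equation : ∀ φ ∈ IsManifold.maximalAtlas 𝓘(ℂ, EuclideanSpace ℂ (Fin m)) ω M,
    ∀ ψ ∈ IsManifold.maximalAtlas 𝓘(ℝ, EuclideanSpace ℝ (Fin n)) ∞ N,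
    ∀ z ∈ φ.target, f (φ.symm z) ∈ ψ.source →
    let F : Fin n → EuclideanSpace ℂ (Fin m) → ℂ := fun i y => ((ψ (f (φ.symm y)) i : ℝ) : ℂ)
    ∀ (α β : Fin m) (i : Fin n),
      dz α (dzbar β (F i)) z
        + ∑ j, ∑ k, (christoffel g ψ i j k (ψ (f (φ.symm z))) : ℂ)
            * dzbar β (F j) z * dz α (F k) z = 0

end Riemannian

end

/-! The proof is a maximum principle on the projective bundle P(T_M). For a tangent vector v ≠ 0
consider the quotient u = |∂f(v)|² / |v|²_H. Numerator and denominator scale by the same factor |c|²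
under v ↦ cv, so u is a function on P(T_M), which is compact because M and the fibres are. Hence u
attains its maximum.

Suppose that the maximum is positive. Near a maximum point take coordinates ζ = (z, w) on P(T_M) and
the holomorphic section W of the tautological bundle, and write log u = log |∂f(W)|² - log |W|²_H.
RC-positivity gives a complex line along which -log |W|²_H is strictly subharmonic
(`HasPositiveEigenvalue.exists_direction`). If log |∂f(W)|² is subharmonic on every complex line,
then log u has positive Laplacian along that line, which is impossible at a maximum
(`IsPluriharmonic.not_isLocalMax`). So ∂f = 0; as f is real, df = 0, and f is constant because M is
connected.

The heart is `log_partialEnergy_subharmonic`. Pluri-harmonicity says that the (1,1)-part of the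
Hessian ∇df vanishes, so ∂f(W) satisfies Cauchy–Riemann equations for the pulled-back Levi-Civita
connection. The Laplacian of log |∂f(W)|² is then a Cauchy–Schwarz defect plus a multiple of the
curvature term ⟨R(df v, df Jv) df W, df JW⟩. This term is not a sectional curvature. However,
differentiating the pluri-harmonic equation once more gives an algebraic identity for R
(`curvature_identity`), which with the Bianchi identity turns the term into half a sum of four
expressions ⟨R(p,q)p,q⟩, each nonnegative when the sectional curvature is non-positive
(`curvature_nonneg`).

All this is done in vector spaces with an abstract metric and connection (`IsLeviCivitaOn`,
`IsPluriharmonicOn`), to which charts are then reduced. -/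

noncomputable section

/-! ## Covariant differentiation along a map -/

section CovariantDerivative

variable {E V : Type*} [NormedAddCommGroup E] [NormedSpace ℝ E]
  [NormedAddCommGroup V] [NormedSpace ℝ V]

/-- The covariant derivative `∇_v s` of a vector field `s` along a map `U`. -/
def covDeriv (Γ : V → V →L[ℝ] V →L[ℝ] V) (U : E → V) (v : E) (s : E → V) (x : E) : V :=
  fderiv ℝ s x v + Γ (U x) (fderiv ℝ U x v) (s x)

/-- The curvature `R(a, b)c` of the connection with Christoffel symbols `Γ`. -/
def curvOp (Γ : V → V →L[ℝ] V →L[ℝ] V) (x a b c : V) : V :=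
  fderiv ℝ Γ x a b c - fderiv ℝ Γ x b a c + Γ x a (Γ x b c) - Γ x b (Γ x a c)

lemma fderiv_fderiv_comm {f : E → V} {x : E} (hf : ContDiffAt ℝ ∞ f x) (v w : E) :
    fderiv ℝ (fderiv ℝ f) x v w = fderiv ℝ (fderiv ℝ f) x w v :=
  (hf.isSymmSndFDerivAt (by simpa using ENat.LEInfty.out)).eq v w

lemma ContDiffAt.fderiv_infty {f : E → V} {x : E} (hf : ContDiffAt ℝ ∞ f x) :
    ContDiffAt ℝ ∞ (fderiv ℝ f) x :=
  hf.fderiv_right (by simp)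

lemma ContDiffAt.fderiv_apply_infty {f : E → V} {x : E} (hf : ContDiffAt ℝ ∞ f x) (v : E) :
    ContDiffAt ℝ ∞ (fun y => fderiv ℝ f y v) x :=
  hf.fderiv_infty.clm_apply contDiffAt_const

lemma ContDiffAt.differentiableAt_infty {f : E → V} {x : E} (hf : ContDiffAt ℝ ∞ f x) :
    DifferentiableAt ℝ f x :=
  hf.differentiableAt (by simp)

lemma fderiv_fderiv_apply {f : E → V} {x : E} (hf : ContDiffAt ℝ ∞ f x) (v w : E) :
    fderiv ℝ (fun y => fderiv ℝ f y w) x v = fderiv ℝ (fderiv ℝ f) x v w := by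
  have h := (hf.fderiv_infty.differentiableAt_infty.hasFDerivAt.clm_apply
    (hasFDerivAt_const w x)).fderiv
  rw [h]; simp

variable {Γ : V → V →L[ℝ] V →L[ℝ] V} {U s : E → V} {x : E}

lemma ContDiffAt.covDeriv_infty (hΓ : ContDiffAt ℝ ∞ Γ (U x)) (hU : ContDiffAt ℝ ∞ U x)
    (hs : ContDiffAt ℝ ∞ s x) (v : E) : ContDiffAt ℝ ∞ (covDeriv Γ U v s) x :=
  (hs.fderiv_apply_infty v).add
    (((hΓ.comp x hU).clm_apply (hU.fderiv_apply_infty v)).clm_apply hs)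

lemma fderiv_covDeriv (hΓ : ContDiffAt ℝ ∞ Γ (U x)) (hU : ContDiffAt ℝ ∞ U x)
    (hs : ContDiffAt ℝ ∞ s x) (v w : E) :
    fderiv ℝ (covDeriv Γ U w s) x v = fderiv ℝ (fderiv ℝ s) x v w
      + fderiv ℝ Γ (U x) (fderiv ℝ U x v) (fderiv ℝ U x w) (s x)
      + Γ (U x) (fderiv ℝ (fderiv ℝ U) x v w) (s x)
      + Γ (U x) (fderiv ℝ U x w) (fderiv ℝ s x v) := by
  have h1 := (hs.fderiv_infty.differentiableAt_infty.hasFDerivAt.clm_apply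
    (hasFDerivAt_const w x))
  have h2 := (hU.fderiv_infty.differentiableAt_infty.hasFDerivAt.clm_apply
    (hasFDerivAt_const w x))
  have h3 := hΓ.differentiableAt_infty.hasFDerivAt.comp x hU.differentiableAt_infty.hasFDerivAt
  have h4 := h1.add ((h3.clm_apply h2).clm_apply hs.differentiableAt_infty.hasFDerivAt)
  have h5 : fderiv ℝ (covDeriv Γ U w s) x = _ := HasFDerivAt.fderiv h4
  rw [h5]
  simp
  abel

/-- The commutator of covariant derivatives along a map is the curvature. -/
lemma covDeriv_comm (hΓ : ContDiffAt ℝ ∞ Γ (U x)) (hU : ContDiffAt ℝ ∞ U x)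
    (hs : ContDiffAt ℝ ∞ s x) (v w : E) :
    covDeriv Γ U v (covDeriv Γ U w s) x - covDeriv Γ U w (covDeriv Γ U v s) x
      = curvOp Γ (U x) (fderiv ℝ U x v) (fderiv ℝ U x w) (s x) := by
  have h1 := fderiv_covDeriv hΓ hU hs v w
  have h2 := fderiv_covDeriv hΓ hU hs w v
  rw [covDeriv, h1, covDeriv.eq_def Γ U w (covDeriv Γ U v s), h2, fderiv_fderiv_comm hs w v, fderiv_fderiv_comm hU w v]
  simp only [covDeriv, curvOp, map_add]
  abel

lemma covDeriv_congr {t : E → V} (h : s =ᶠ[nhds x] t) (v : E) :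
    covDeriv Γ U v s x = covDeriv Γ U v t x := by
  rw [covDeriv, covDeriv, h.fderiv_eq, h.eq_of_nhds]

lemma covDeriv_neg (v : E) : covDeriv Γ U v (fun y => -s y) x = -covDeriv Γ U v s x := by
  simp only [covDeriv, fderiv_fun_neg, map_neg, neg_apply]
  abel

/-- A metric which is parallel for the connection `Γ`, on an open set `Ω`. -/
structure IsLeviCivitaOn (G : V → V →L[ℝ] V →L[ℝ] ℝ) (Γ : V → V →L[ℝ] V →L[ℝ] V) (Ω : Set V) :
    Prop where
  isOpen : IsOpen Ω
  smooth_metric : ∀ x ∈ Ω, ContDiffAt ℝ ∞ G x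
  smooth_connection : ∀ x ∈ Ω, ContDiffAt ℝ ∞ Γ x
  symm : ∀ x ∈ Ω, ∀ a b, G x a b = G x b a
  pos : ∀ x ∈ Ω, ∀ a, a ≠ 0 → 0 < G x a a
  compat : ∀ x ∈ Ω, ∀ a b c, fderiv ℝ G x a b c = G x (Γ x a b) c + G x b (Γ x a c)
  torsion_free : ∀ x ∈ Ω, ∀ a b, Γ x a b = Γ x b a

variable {G : V → V →L[ℝ] V →L[ℝ] ℝ} {Ω : Set V}

namespace IsLeviCivitaOn

lemma nonneg (h : IsLeviCivitaOn G Γ Ω) {x : V} (hx : x ∈ Ω) (a : V) : 0 ≤ G x a a := by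
  by_cases ha : a = 0
  · simp [ha]
  · exact (h.pos x hx a ha).le

lemma fderiv_metric_apply (h : IsLeviCivitaOn G Γ Ω) {t : E → V} (hx : U x ∈ Ω)
    (hU : ContDiffAt ℝ ∞ U x) (hs : ContDiffAt ℝ ∞ s x) (ht : ContDiffAt ℝ ∞ t x) (v : E) :
    fderiv ℝ (fun y => G (U y) (s y) (t y)) x v
      = G (U x) (covDeriv Γ U v s x) (t x) + G (U x) (s x) (covDeriv Γ U v t x) := by
  have h3 := (h.smooth_metric _ hx).differentiableAt_infty.hasFDerivAt.comp x
    hU.differentiableAt_infty.hasFDerivAt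
  have h4 := ((h3.clm_apply hs.differentiableAt_infty.hasFDerivAt).clm_apply
    ht.differentiableAt_infty.hasFDerivAt).fderiv
  simp only [Function.comp_def] at h4
  rw [h4]
  simp only [covDeriv, map_add, add_apply, ContinuousLinearMap.flip_apply,
    ContinuousLinearMap.comp_apply, h.compat _ hx]
  abel

lemma smooth_inner (h : IsLeviCivitaOn G Γ Ω) {t : E → V} (hx : U x ∈ Ω)
    (hU : ContDiffAt ℝ ∞ U x) (hs : ContDiffAt ℝ ∞ s x) (ht : ContDiffAt ℝ ∞ t x) :
    ContDiffAt ℝ ∞ (fun y => G (U y) (s y) (t y)) x :=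
  ((((h.smooth_metric _ hx).comp x hU).clm_apply hs).clm_apply ht)

lemma smooth_covDeriv (h : IsLeviCivitaOn G Γ Ω) (hx : U x ∈ Ω)
    (hU : ContDiffAt ℝ ∞ U x) (hs : ContDiffAt ℝ ∞ s x) (v : E) :
    ContDiffAt ℝ ∞ (covDeriv Γ U v s) x :=
  ContDiffAt.covDeriv_infty (h.smooth_connection _ hx) hU hs v

/-- The second derivative of `|s|²` along a map. -/
lemma fderiv_fderiv_metric (h : IsLeviCivitaOn G Γ Ω) {O : Set E} (hO : IsOpen O) (hxO : x ∈ O)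
    (hUO : ∀ y ∈ O, U y ∈ Ω) (hU : ∀ y ∈ O, ContDiffAt ℝ ∞ U y)
    (hs : ∀ y ∈ O, ContDiffAt ℝ ∞ s y) (v w : E) :
    fderiv ℝ (fun y => fderiv ℝ (fun z => G (U z) (s z) (s z)) y w) x v
      = 2 * (G (U x) (covDeriv Γ U v (covDeriv Γ U w s) x) (s x)
        + G (U x) (covDeriv Γ U w s x) (covDeriv Γ U v s x)) := by
  have h1 : (fun y => fderiv ℝ (fun z => G (U z) (s z) (s z)) y w)
      =ᶠ[nhds x] fun y => (2 : ℝ) • G (U y) (covDeriv Γ U w s y) (s y) := by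
    filter_upwards [hO.mem_nhds hxO] with y hy
    rw [h.fderiv_metric_apply (hUO y hy) (hU y hy) (hs y hy) (hs y hy),
      h.symm _ (hUO y hy) (s y)]
    simp; ring
  rw [h1.fderiv_eq, fderiv_fun_const_smul]
  · have h2 := h.fderiv_metric_apply (hUO x hxO) (hU x hxO)
      (h.smooth_covDeriv (hUO x hxO) (hU x hxO) (hs x hxO) w) (hs x hxO) v
    simp [h2]
  · exact (h.smooth_inner (hUO x hxO) (hU x hxO)
      (h.smooth_covDeriv (hUO x hxO) (hU x hxO) (hs x hxO) w) (hs x hxO)).differentiableAt_infty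

lemma curvOp_swap (x a b c : V) : curvOp Γ x b a c = -curvOp Γ x a b c := by
  simp only [curvOp]; abel

/-- For the identity map and the constant field `c`, `fderiv_fderiv_metric` computes both mixed
second derivatives of |c|². They are equal, and their difference is twice the commutator term paired
with `c`. -/
lemma curvOp_self_right (h : IsLeviCivitaOn G Γ Ω) {x : V} (hx : x ∈ Ω) (a b c : V) :
    G x (curvOp Γ x a b c) c = 0 := by
  have hid : ∀ y ∈ Ω, ContDiffAt ℝ ∞ (fun z : V => z) y := fun y _ => contDiffAt_id
  have hc : ∀ y ∈ Ω, ContDiffAt ℝ ∞ (fun _ : V => c) y := fun y _ => contDiffAt_const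
  have h1 := h.fderiv_fderiv_metric h.isOpen hx (fun y hy => hy) hid hc a b
  have h2 := h.fderiv_fderiv_metric h.isOpen hx (fun y hy => hy) hid hc b a
  have hs := h.smooth_inner (U := fun z => z) hx (hid x hx) (hc x hx) (hc x hx)
  rw [fderiv_fderiv_apply hs] at h1 h2
  rw [fderiv_fderiv_comm hs] at h1
  rw [h1] at h2
  have h3 := covDeriv_comm (U := fun z => z) (h.smooth_connection _ hx) (hid x hx) (hc x hx) a b
  simp only [fderiv_fun_id, ContinuousLinearMap.id_apply] at h3
  rw [← h3, map_sub, sub_apply]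
  have := h.symm _ hx (covDeriv Γ (fun x => x) b (fun _ => c) x)
    (covDeriv Γ (fun x => x) a (fun _ => c) x)
  linarith

lemma curvOp_add_right (x a b c d : V) :
    curvOp Γ x a b (c + d) = curvOp Γ x a b c + curvOp Γ x a b d := by
  simp only [curvOp, map_add]; abel

lemma curvOp_skew (h : IsLeviCivitaOn G Γ Ω) {x : V} (hx : x ∈ Ω) (a b c d : V) :
    G x (curvOp Γ x a b c) d = -G x (curvOp Γ x a b d) c := by
  have h1 := h.curvOp_self_right hx a b (c + d)
  have h2 := h.curvOp_self_right hx a b c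
  have h3 := h.curvOp_self_right hx a b d
  rw [curvOp_add_right] at h1
  simp only [map_add, add_apply] at h1
  linarith

lemma fderiv_torsion_free (h : IsLeviCivitaOn G Γ Ω) {x : V} (hx : x ∈ Ω) (a b c : V) :
    fderiv ℝ Γ x a b c = fderiv ℝ Γ x a c b := by
  have hd := (h.smooth_connection x hx).differentiableAt_infty.hasFDerivAt
  have e : ∀ b c, fderiv ℝ (fun y => Γ y b c) x a = fderiv ℝ Γ x a b c := by
    intro b c
    rw [((hd.clm_apply (hasFDerivAt_const b x)).clm_apply (hasFDerivAt_const c x)).fderiv]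
    simp
  rw [← e, ← e]
  have : (fun y => Γ y b c) =ᶠ[nhds x] fun y => Γ y c b := by
    filter_upwards [h.isOpen.mem_nhds hx] with y hy using h.torsion_free y hy b c
  rw [this.fderiv_eq]

lemma bianchi (h : IsLeviCivitaOn G Γ Ω) {x : V} (hx : x ∈ Ω) (a b c : V) :
    curvOp Γ x a b c + curvOp Γ x b c a + curvOp Γ x c a b = 0 := by
  simp only [curvOp]
  rw [h.fderiv_torsion_free hx a c b, h.fderiv_torsion_free hx b c a,
    h.fderiv_torsion_free hx c b a, h.torsion_free x hx c b, h.torsion_free x hx a c,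
    h.torsion_free x hx b a]
  abel

/-- The pair symmetry of the Riemann curvature tensor. -/
lemma curvOp_pair_symm (h : IsLeviCivitaOn G Γ Ω) {x : V} (hx : x ∈ Ω) (a b c d : V) :
    G x (curvOp Γ x a b c) d = G x (curvOp Γ x c d a) b := by
  have B : ∀ a b c d, G x (curvOp Γ x a b c) d + G x (curvOp Γ x b c a) d
      + G x (curvOp Γ x c a b) d = 0 := by
    intro a b c d
    have := congrArg (fun u => G x u d) (h.bianchi hx a b c)
    simpa only [map_add, add_apply, map_zero, zero_apply] using this
  have S := fun a b c d => h.curvOp_skew hx a b c d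
  have A : ∀ a b c d, G x (curvOp Γ x b a c) d = -G x (curvOp Γ x a b c) d := by
    intro a b c d
    rw [curvOp_swap]; simp
  -- The octahedron argument: the Bianchi identities for the four cyclic rotations of `a, b, c, d`
  -- are combined, and skew-symmetry in each pair cancels everything but the two sides of the claim.
  linarith [B a b c d, B b c d a, B c d a b, B d a b c, S a b c d, S b c a d, S c a b d,
    S b c d a, S c d b a, S d b c a, S c d a b, S d a c b, S a c d b, S d a b c, S a b d c,
    S b d a c, A a b c d, A a c b d, A b d c a, A a c d b, A b d a c, A d b a c, A c a d b]

end IsLeviCivitaOn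

end CovariantDerivative

/-! ## Pluriharmonic maps in local coordinates -/

section Pluriharmonic

variable {E V : Type*} [NormedAddCommGroup E] [NormedSpace ℝ E]
  [NormedAddCommGroup V] [NormedSpace ℝ V]

/-- The covariant Hessian `(∇dF)(v, w)` of the map `F`. -/
def covHess (Γ : V → V →L[ℝ] V →L[ℝ] V) (F : E → V) (v w : E) (x : E) : V :=
  covDeriv Γ F v (fun y => fderiv ℝ F y w) x

/-- A smooth map on an open set of a vector space with complex structure `J`, into an open set of
coordinates, such that the `(1,1)`-part of the covariant Hessian vanishes. -/
structure IsPluriharmonicOn (Γ : V → V →L[ℝ] V →L[ℝ] V) (Ω : Set V) (J : E →L[ℝ] E)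
    (F : E → V) (O : Set E) : Prop where
  isOpen : IsOpen O
  smooth : ∀ x ∈ O, ContDiffAt ℝ ∞ F x
  mapsTo : ∀ x ∈ O, F x ∈ Ω
  sq : ∀ v, J (J v) = -v
  hess : ∀ x ∈ O, ∀ v w, covHess Γ F (J v) (J w) x = -covHess Γ F v w x

variable {Γ : V → V →L[ℝ] V →L[ℝ] V} {G : V → V →L[ℝ] V →L[ℝ] ℝ} {Ω : Set V}
  {J : E →L[ℝ] E} {F : E → V} {O : Set E}

lemma covHess_eq {x : E} (hF : ContDiffAt ℝ ∞ F x) (v w : E) :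
    covHess Γ F v w x = fderiv ℝ (fderiv ℝ F) x v w + Γ (F x) (fderiv ℝ F x v) (fderiv ℝ F x w) := by
  rw [covHess, covDeriv, fderiv_fderiv_apply hF]

lemma covHess_neg_right {x : E} (hF : ContDiffAt ℝ ∞ F x) (v w : E) :
    covHess Γ F v (-w) x = -covHess Γ F v w x := by
  simp only [covHess_eq hF, map_neg]; abel

namespace IsPluriharmonicOn

/-- Replace `w` by `J w` in `hess` and use J² = -1. This form yields one of the two Cauchy–Riemann
equations for dF(W); `hess` itself yields the other. -/
lemma hess_left (hF : IsPluriharmonicOn Γ Ω J F O) {x : E} (hx : x ∈ O) (v w : E) :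
    covHess Γ F (J v) w x = covHess Γ F v (J w) x := by
  have := hF.hess x hx v (J w)
  rw [hF.sq, covHess_neg_right (hF.smooth x hx)] at this
  exact neg_injective this

/-- The identity `R(∂̄_v F, ∂̄_w F) ∂_v F = 0` for a pluriharmonic map (real part). -/
lemma curvature_identity (hF : IsPluriharmonicOn Γ Ω J F O) (h : IsLeviCivitaOn G Γ Ω)
    {x : E} (hx : x ∈ O) (v w : E) :
    curvOp Γ (F x) (fderiv ℝ F x v) (fderiv ℝ F x w) (fderiv ℝ F x v)
      - curvOp Γ (F x) (fderiv ℝ F x (J v)) (fderiv ℝ F x (J w)) (fderiv ℝ F x v)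
      + curvOp Γ (F x) (fderiv ℝ F x v) (fderiv ℝ F x (J w)) (fderiv ℝ F x (J v))
      + curvOp Γ (F x) (fderiv ℝ F x (J v)) (fderiv ℝ F x w) (fderiv ℝ F x (J v)) = 0 := by
  -- The left side is the real part of R(v + iJv, w + iJw)(v - iJv), all vectors being pushed
  -- forward by dF. Since `covHess` is a covariant derivative of dF, each curvature term is a
  -- commutator of third covariant derivatives. The relations on `covHess` hold near `x`, so they
  -- may be differentiated, and all terms cancel.
  have R : ∀ a b c, curvOp Γ (F x) (fderiv ℝ F x a) (fderiv ℝ F x b) (fderiv ℝ F x c)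
      = covDeriv Γ F a (covHess Γ F b c) x - covDeriv Γ F b (covHess Γ F a c) x := fun a b c =>
    (covDeriv_comm (h.smooth_connection _ (hF.mapsTo x hx)) (hF.smooth x hx)
      ((hF.smooth x hx).fderiv_apply_infty c) a b).symm
  have T1 : ∀ a b c, covDeriv Γ F a (covHess Γ F (J b) c) x
      = covDeriv Γ F a (covHess Γ F b (J c)) x := by
    intro a b c
    refine covDeriv_congr ?_ a
    filter_upwards [hF.isOpen.mem_nhds hx] with y hy using hF.hess_left hy b c
  have T2 : ∀ a b c, covDeriv Γ F a (covHess Γ F (J b) (J c)) x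
      = -covDeriv Γ F a (covHess Γ F b c) x := by
    intro a b c
    rw [← covDeriv_neg]
    refine covDeriv_congr ?_ a
    filter_upwards [hF.isOpen.mem_nhds hx] with y hy using hF.hess y hy b c
  have e : ∀ a b c, covDeriv Γ F a (covHess Γ F b (J (J c))) x
      = -covDeriv Γ F a (covHess Γ F b c) x := by
    intro a b c
    rw [← T1, T2]
  simp only [R, T1, e]
  abel

/-- For a pluriharmonic map into a non-positively curved space,
`⟨R(dF v, dF Jv) dF w, dF Jw⟩ ≥ 0`. -/
lemma curvature_nonneg (hF : IsPluriharmonicOn Γ Ω J F O) (h : IsLeviCivitaOn G Γ Ω)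
    (hK : ∀ y ∈ Ω, ∀ a b, 0 ≤ G y (curvOp Γ y a b a) b) {x : E} (hx : x ∈ O) (v w : E) :
    0 ≤ G (F x) (curvOp Γ (F x) (fderiv ℝ F x v) (fderiv ℝ F x (J v)) (fderiv ℝ F x w))
      (fderiv ℝ F x (J w)) := by
  have hy := hF.mapsTo x hx
  -- The identity for (v, w) is paired with dF w, and that for (v, Jw) with dF Jw. Let a, b, c, d be
  -- the images of v, Jv, w, Jw. The sum contains the four nonnegative terms ⟨R(p,q)p,q⟩ with p ∈
  -- {a, b}, q ∈ {c, d}; by pair symmetry and Bianchi the remaining terms add up to -2⟨R(a,b)c,d⟩.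
  have h1 := congrArg (fun u => G (F x) u (fderiv ℝ F x w)) (hF.curvature_identity h hx v w)
  have h2 := congrArg (fun u => G (F x) u (fderiv ℝ F x (J w)))
    (hF.curvature_identity h hx v (J w))
  rw [hF.sq w] at h2
  generalize fderiv ℝ F x v = a at *
  generalize fderiv ℝ F x (J v) = b at *
  have hneg : fderiv ℝ F x (-w) = -fderiv ℝ F x w := map_neg _ _
  rw [hneg] at h2
  generalize fderiv ℝ F x w = c at *
  generalize fderiv ℝ F x (J w) = d at *
  have hcn : ∀ p q r, curvOp Γ (F x) p (-q) r = -curvOp Γ (F x) p q r := by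
    intro p q r; simp only [curvOp, map_neg, neg_apply]; abel
  simp only [hcn, map_add, map_sub, map_neg, add_apply, sub_apply, neg_apply, map_zero,
    zero_apply] at h1 h2
  have B := congrArg (fun u => G (F x) u d) (h.bianchi hy a b c)
  simp only [map_add, add_apply, map_zero, zero_apply] at B
  have A : G (F x) (curvOp Γ (F x) c a b) d = - G (F x) (curvOp Γ (F x) a c b) d := by
    rw [IsLeviCivitaOn.curvOp_swap]; simp
  have p1 := h.curvOp_pair_symm hy a c b d
  have p2 := h.curvOp_pair_symm hy a d b c
  linarith [hK _ hy a c, hK _ hy b d, hK _ hy b c, hK _ hy a d]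

end IsPluriharmonicOn

variable {E' : Type*} [NormedAddCommGroup E'] [NormedSpace ℝ E'] {β l : E' →L[ℝ] E} {c : E}

lemma contDiffAt_fderiv_affine {ζ : E'} (hF : ContDiffAt ℝ ∞ F (β ζ)) :
    ContDiffAt ℝ ∞ (fun ξ => fderiv ℝ F (β ξ) (l ξ + c)) ζ :=
  (hF.fderiv_infty.comp ζ β.contDiff.contDiffAt).clm_apply
    (l.contDiff.contDiffAt.add contDiffAt_const)

/-- The covariant derivative of `dF(W)` for an affine vector field `W`. -/
lemma covDeriv_fderiv_affine {ζ : E'} (hF : ContDiffAt ℝ ∞ F (β ζ)) (v : E') :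
    covDeriv Γ (fun ξ => F (β ξ)) v (fun ξ => fderiv ℝ F (β ξ) (l ξ + c)) ζ
      = covHess Γ F (β v) (l ζ + c) (β ζ) + fderiv ℝ F (β ζ) (l v) := by
  have h1 := (hF.fderiv_infty.differentiableAt_infty.hasFDerivAt.comp ζ β.hasFDerivAt).clm_apply
    (l.hasFDerivAt.add_const c (x := ζ))
  have h2 := hF.differentiableAt_infty.hasFDerivAt.comp ζ β.hasFDerivAt
  have h1' := h1.fderiv
  have h2' := h2.fderiv
  simp only [Function.comp_def] at h1' h2'
  rw [covDeriv, h1', h2', covHess_eq hF]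
  simp
  abel

end Pluriharmonic

/-! ## The logarithm of the energy density is plurisubharmonic -/

section LogSubharmonic

variable {E V : Type*} [NormedAddCommGroup E] [NormedSpace ℝ E]
  [NormedAddCommGroup V] [NormedSpace ℝ V]

lemma fderiv_fderiv_log {u : E → ℝ} {x : E} (hu : ContDiffAt ℝ ∞ u x) (h0 : u x ≠ 0) (v : E) :
    fderiv ℝ (fderiv ℝ fun y => Real.log (u y)) x v v
      = fderiv ℝ (fun y => fderiv ℝ u y v) x v / u x - (fderiv ℝ u x v) ^ 2 / u x ^ 2 := by
  rw [← fderiv_fderiv_apply (hu.log h0)]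
  have h1 : (fun y => fderiv ℝ (fun y => Real.log (u y)) y v)
      =ᶠ[nhds x] fun y => (u y)⁻¹ * fderiv ℝ u y v := by
    have hd : ∀ᶠ y in nhds x, DifferentiableAt ℝ u y :=
      ((hu.of_le (by simp : (1 : WithTop ℕ∞) ≤ ∞)).eventually (by simp)).mono
        fun y hy => hy.differentiableAt (by simp)
    filter_upwards [hd, hu.continuousAt.eventually_ne h0] with y hy hy0
    rw [(hy.hasFDerivAt.log hy0).fderiv]
    simp
  rw [h1.fderiv_eq]
  have h2 := (((hasDerivAt_inv h0).hasFDerivAt).comp x hu.differentiableAt_infty.hasFDerivAt).mul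
    (hu.fderiv_apply_infty v).differentiableAt_infty.hasFDerivAt
  have h3 := h2.fderiv
  simp only [Function.comp_def, Pi.mul_def] at h3
  rw [h3]
  simp
  field_simp
  ring

/-- The Cauchy-Schwarz inequality for the Hermitian extension of a real scalar product. -/
lemma hermitian_cauchy_schwarz (g : V →L[ℝ] V →L[ℝ] ℝ) (symm : ∀ a b, g a b = g b a)
    (nonneg : ∀ a, 0 ≤ g a a) (a b p q : V) (h0 : 0 < g p p + g q q) :
    (g a p + g b q) ^ 2 + (g b p - g a q) ^ 2 ≤ (g p p + g q q) * (g a a + g b b) := by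
  set N := g p p + g q q with hN
  set s := g a p + g b q with hs
  set t := g b p - g a q with ht
  -- With A = a - ib and Z = p - iq, the Hermitian product ⟨A,Z⟩ is s - it. The two vectors are the
  -- components of N A - ⟨A,Z⟩ Z, whose squared length is N(N|A|² - |⟨A,Z⟩|²).
  have h1 := nonneg (N • a - s • p + t • q)
  have h2 := nonneg (N • b - s • q - t • p)
  simp only [map_add, map_sub, map_smul, add_apply, sub_apply, smul_apply, smul_eq_mul,
    symm p a, symm q a, symm p b, symm q b, symm q p] at h1 h2
  have key : 0 ≤ N * (N * (g a a + g b b) - (s ^ 2 + t ^ 2)) := by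
    refine (add_nonneg h1 h2).trans_eq ?_
    simp only [hN, hs, ht]
    ring
  have := (mul_nonneg_iff_of_pos_left h0).1 key
  linarith

variable {Γ : V → V →L[ℝ] V →L[ℝ] V} {G : V → V →L[ℝ] V →L[ℝ] ℝ} {Ω : Set V}
  {J : E →L[ℝ] E} {F : E → V} {O : Set E}
  {E' : Type*} [NormedAddCommGroup E'] [NormedSpace ℝ E']

/-- The squared length `|∂F(W)|²` (up to a constant factor) of the `(1,0)`-derivative of `F` along
the affine family of tangent vectors `W = l ξ + c` at `β ξ`. -/
def partialEnergy (G : V → V →L[ℝ] V →L[ℝ] ℝ) (J : E →L[ℝ] E) (F : E → V) (β l : E' →L[ℝ] E)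
    (c : E) (ξ : E') : ℝ :=
  G (F (β ξ)) (fderiv ℝ F (β ξ) (l ξ + c)) (fderiv ℝ F (β ξ) (l ξ + c))
    + G (F (β ξ)) (fderiv ℝ F (β ξ) (J (l ξ + c))) (fderiv ℝ F (β ξ) (J (l ξ + c)))

variable {β l : E' →L[ℝ] E} {c : E}

lemma partialEnergy_contDiffAt (hF : IsPluriharmonicOn Γ Ω J F O) (h : IsLeviCivitaOn G Γ Ω)
    {ζ : E'} (hζ : β ζ ∈ O) : ContDiffAt ℝ ∞ (partialEnergy G J F β l c) ζ := by
  have hs := hF.smooth _ hζ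
  have hU : ContDiffAt ℝ ∞ (fun ξ => F (β ξ)) ζ := hs.comp ζ β.contDiff.contDiffAt
  have hP := contDiffAt_fderiv_affine (l := l) (c := c) hs
  have hQ := contDiffAt_fderiv_affine (l := J.comp l) (c := J c) hs
  simp only [ContinuousLinearMap.comp_apply, ← map_add] at hQ
  exact (h.smooth_inner (U := fun ξ => F (β ξ)) (hF.mapsTo _ hζ) hU hP hP).add
    (h.smooth_inner (U := fun ξ => F (β ξ)) (hF.mapsTo _ hζ) hU hQ hQ)

/-- The logarithm of `|∂F(W)|²` is subharmonic on complex lines. -/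
theorem log_partialEnergy_subharmonic (hF : IsPluriharmonicOn Γ Ω J F O)
    (h : IsLeviCivitaOn G Γ Ω) (hK : ∀ y ∈ Ω, ∀ a b, 0 ≤ G y (curvOp Γ y a b a) b)
    {ζ : E'} (hζ : β ζ ∈ O) (h0 : 0 < partialEnergy G J F β l c ζ) {v v' : E'}
    (hβ : β v' = J (β v)) (hl : l v' = J (l v)) :
    0 ≤ fderiv ℝ (fderiv ℝ fun ξ => Real.log (partialEnergy G J F β l c ξ)) ζ v v
      + fderiv ℝ (fderiv ℝ fun ξ => Real.log (partialEnergy G J F β l c ξ)) ζ v' v' := by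
  have hsm := partialEnergy_contDiffAt (l := l) (c := c) hF h hζ
  rw [fderiv_fderiv_log hsm h0.ne', fderiv_fderiv_log hsm h0.ne']
  set U : E' → V := fun ξ => F (β ξ) with hUdef
  set P : E' → V := fun ξ => fderiv ℝ F (β ξ) (l ξ + c) with hPdef
  set Q : E' → V := fun ξ => fderiv ℝ F (β ξ) ((J.comp l) ξ + J c) with hQdef
  have hH : partialEnergy G J F β l c
      = fun ξ => G (U ξ) (P ξ) (P ξ) + G (U ξ) (Q ξ) (Q ξ) := by
    funext ξ; simp [partialEnergy, hUdef, hPdef, hQdef]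
  have hO' : IsOpen (β ⁻¹' O) := hF.isOpen.preimage β.continuous
  have hUs : ∀ ξ ∈ β ⁻¹' O, ContDiffAt ℝ ∞ U ξ := fun ξ hξ =>
    (hF.smooth _ hξ).comp ξ β.contDiff.contDiffAt
  have hPs : ∀ ξ ∈ β ⁻¹' O, ContDiffAt ℝ ∞ P ξ := fun ξ hξ =>
    contDiffAt_fderiv_affine (hF.smooth _ hξ)
  have hQs : ∀ ξ ∈ β ⁻¹' O, ContDiffAt ℝ ∞ Q ξ := fun ξ hξ =>
    contDiffAt_fderiv_affine (hF.smooth _ hξ)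
  have hUΩ : ∀ ξ ∈ β ⁻¹' O, U ξ ∈ Ω := fun ξ hξ => hF.mapsTo _ hξ
  have hPd : ∀ ξ ∈ β ⁻¹' O, ∀ w, covDeriv Γ U w P ξ
      = covHess Γ F (β w) (l ξ + c) (β ξ) + fderiv ℝ F (β ξ) (l w) := fun ξ hξ w =>
    covDeriv_fderiv_affine (hF.smooth _ hξ) w
  have hQd : ∀ ξ ∈ β ⁻¹' O, ∀ w, covDeriv Γ U w Q ξ
      = covHess Γ F (β w) (J (l ξ + c)) (β ξ) + fderiv ℝ F (β ξ) (J (l w)) := fun ξ hξ w => by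
    rw [map_add]
    exact covDeriv_fderiv_affine (hF.smooth _ hξ) w
  -- `e1` and `e2` are the Cauchy–Riemann equations: the operator ∇_v + i∇_{v'} annihilates P - iQ,
  -- that is, ∂F(W) is holomorphic along the line.
  have e1 : ∀ ξ ∈ β ⁻¹' O, covDeriv Γ U v' Q ξ = -covDeriv Γ U v P ξ := fun ξ hξ => by
    rw [hPd ξ hξ, hQd ξ hξ, hβ, hl, hF.hess _ hξ, hF.sq, map_neg]; abel
  have e2 : ∀ ξ ∈ β ⁻¹' O, covDeriv Γ U v' P ξ = covDeriv Γ U v Q ξ := fun ξ hξ => by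
    rw [hPd ξ hξ, hQd ξ hξ, hβ, hl, hF.hess_left hξ]
  have hy := hUΩ ζ hζ
  have hnb := hO'.mem_nhds hζ
  -- The Cauchy–Riemann equations hold in a neighbourhood, so they may be differentiated. Together
  -- with the commutators `k1`, `k2` they give ∇_{v'}∇_{v'}P = -∇_v∇_vP - R(v,v')Q and ∇_{v'}∇_{v'}Q
  -- = -∇_v∇_vQ + R(v,v')P. In the Laplacian the second derivatives of P and Q therefore cancel.
  have c1 := covDeriv_congr (Γ := Γ) (U := U) (Filter.eventually_of_mem hnb e1) v'
  have c2 := covDeriv_congr (Γ := Γ) (U := U) (Filter.eventually_of_mem hnb e2) v'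
  rw [covDeriv_neg] at c1
  have k1 := covDeriv_comm (h.smooth_connection _ hy) (hUs ζ hζ) (hPs ζ hζ) v v'
  have k2 := covDeriv_comm (h.smooth_connection _ hy) (hUs ζ hζ) (hQs ζ hζ) v v'
  rw [covDeriv_congr (Γ := Γ) (U := U) (Filter.eventually_of_mem hnb e2) v] at k1
  rw [covDeriv_congr (Γ := Γ) (U := U) (Filter.eventually_of_mem hnb e1) v, covDeriv_neg] at k2
  have dU : ∀ w, fderiv ℝ U ζ w = fderiv ℝ F (β ζ) (β w) := fun w => by
    have := ((hF.smooth _ hζ).differentiableAt_infty.hasFDerivAt.comp ζ β.hasFDerivAt).fderiv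
    simp only [Function.comp_def] at this
    rw [hUdef, this]; rfl
  have hR : 0 ≤ G (U ζ) (curvOp Γ (U ζ) (fderiv ℝ U ζ v) (fderiv ℝ U ζ v') (P ζ)) (Q ζ) := by
    have := hF.curvature_nonneg h hK hζ (β v) (l ζ + c)
    rw [dU, dU, hβ]
    simpa [hUdef, hPdef, hQdef] using this
  have hskew := h.curvOp_skew hy (fderiv ℝ U ζ v) (fderiv ℝ U ζ v') (P ζ) (Q ζ)
  have smP : ContDiffAt ℝ ∞ (fun ξ => G (U ξ) (P ξ) (P ξ)) ζ :=
    h.smooth_inner hy (hUs ζ hζ) (hPs ζ hζ) (hPs ζ hζ)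
  have smQ : ContDiffAt ℝ ∞ (fun ξ => G (U ξ) (Q ξ) (Q ξ)) ζ :=
    h.smooth_inner hy (hUs ζ hζ) (hQs ζ hζ) (hQs ζ hζ)
  have D1 : ∀ w, fderiv ℝ (partialEnergy G J F β l c) ζ w
      = 2 * (G (U ζ) (covDeriv Γ U w P ζ) (P ζ) + G (U ζ) (covDeriv Γ U w Q ζ) (Q ζ)) := by
    intro w
    rw [hH, fderiv_fun_add smP.differentiableAt_infty smQ.differentiableAt_infty, add_apply,
      h.fderiv_metric_apply hy (hUs ζ hζ) (hPs ζ hζ) (hPs ζ hζ),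
      h.fderiv_metric_apply hy (hUs ζ hζ) (hQs ζ hζ) (hQs ζ hζ), h.symm _ hy (P ζ),
      h.symm _ hy (Q ζ)]
    ring
  have D2 : ∀ w, fderiv ℝ (fun y => fderiv ℝ (partialEnergy G J F β l c) y w) ζ w
      = 2 * (G (U ζ) (covDeriv Γ U w (covDeriv Γ U w P) ζ) (P ζ)
          + G (U ζ) (covDeriv Γ U w P ζ) (covDeriv Γ U w P ζ))
        + 2 * (G (U ζ) (covDeriv Γ U w (covDeriv Γ U w Q) ζ) (Q ζ)
          + G (U ζ) (covDeriv Γ U w Q ζ) (covDeriv Γ U w Q ζ)) := by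
    intro w
    rw [← h.fderiv_fderiv_metric hO' hζ hUΩ hUs hPs w w,
      ← h.fderiv_fderiv_metric hO' hζ hUΩ hUs hQs w w, fderiv_fderiv_apply smP,
      fderiv_fderiv_apply smQ, fderiv_fderiv_apply hsm]
    have : fderiv ℝ (partialEnergy G J F β l c) =ᶠ[nhds ζ] fun ξ =>
        fderiv ℝ (fun ξ => G (U ξ) (P ξ) (P ξ)) ξ + fderiv ℝ (fun ξ => G (U ξ) (Q ξ) (Q ξ)) ξ := by
      filter_upwards [hnb] with ξ hξ
      rw [hH]
      exact fderiv_fun_add (h.smooth_inner (hUΩ ξ hξ) (hUs ξ hξ) (hPs ξ hξ)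
        (hPs ξ hξ)).differentiableAt_infty (h.smooth_inner (hUΩ ξ hξ) (hUs ξ hξ) (hQs ξ hξ)
        (hQs ξ hξ)).differentiableAt_infty
    rw [this.fderiv_eq, fderiv_fun_add smP.fderiv_infty.differentiableAt_infty
      smQ.fderiv_infty.differentiableAt_infty]
    rfl
  rw [D1, D1, D2, D2, c1, c2, e1 ζ hζ, e2 ζ hζ]
  have k1' := congrArg (fun u => G (U ζ) u (Q ζ)) k1
  have k2' := congrArg (fun u => G (U ζ) u (P ζ)) k2
  simp only [map_sub, map_neg, sub_apply, neg_apply] at k1' k2' ⊢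
  have h0' : 0 < G (U ζ) (P ζ) (P ζ) + G (U ζ) (Q ζ) (Q ζ) := by
    have := h0; rw [hH] at this; exact this
  -- With A = ∇_vP and B = ∇_vQ, the Laplacian of the energy is 4(|A|² + |B|²) + 4⟨R(v,v')P,Q⟩. The
  -- sum of the squares of its first derivatives along v and v' is four times the left side of `cs`.
  have cs := hermitian_cauchy_schwarz (G (U ζ)) (h.symm _ hy) (h.nonneg hy)
    (covDeriv Γ U v P ζ) (covDeriv Γ U v Q ζ) (P ζ) (Q ζ) h0'
  have hN : partialEnergy G J F β l c ζ
      = G (U ζ) (P ζ) (P ζ) + G (U ζ) (Q ζ) (Q ζ) := congrFun hH ζ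
  have split : ∀ N X Y Z T : ℝ, 0 < N → Y ^ 2 + T ^ 2 ≤ N * (X + Z) →
      0 ≤ X / N - Y ^ 2 / N ^ 2 + (Z / N - T ^ 2 / N ^ 2) := by
    intro N X Y Z T hN hle
    have : X / N - Y ^ 2 / N ^ 2 + (Z / N - T ^ 2 / N ^ 2)
        = (N * (X + Z) - (Y ^ 2 + T ^ 2)) / N ^ 2 := by field_simp; ring
    rw [this]
    exact div_nonneg (by linarith) (by positivity)
  refine split _ _ _ _ _ h0 ?_
  rw [hN]
  have := mul_nonneg h0'.le hR
  nlinarith [cs, this, k1', k2', hskew]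

end LogSubharmonic

/-! ## Wirtinger calculus -/

section Wirtinger

variable {ι : Type*} [Fintype ι]

variable (ι) in
/-- Multiplication by `i` as a real linear map. -/
def mulI : EuclideanSpace ℂ ι →L[ℝ] EuclideanSpace ℂ ι :=
  (Complex.I • ContinuousLinearMap.id ℂ (EuclideanSpace ℂ ι)).restrictScalars ℝ

lemma mulI_apply (v : EuclideanSpace ℂ ι) : mulI ι v = Complex.I • v := rfl

lemma mulI_mulI (v : EuclideanSpace ℂ ι) : mulI ι (mulI ι v) = -v := by
  rw [mulI_apply, mulI_apply, smul_smul, Complex.I_mul_I, neg_one_smul]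

/-- The sesquilinear form associated with a real bilinear form on a complex vector space: four
times the components `β(∂_x, ∂̄_y)`. -/
def leviForm (β : EuclideanSpace ℂ ι →L[ℝ] EuclideanSpace ℂ ι →L[ℝ] ℝ)
    (x y : EuclideanSpace ℂ ι) : ℂ :=
  (β x y + β (mulI ι x) (mulI ι y) : ℝ)
    + Complex.I * (β x (mulI ι y) - β (mulI ι x) y : ℝ)

variable {β : EuclideanSpace ℂ ι →L[ℝ] EuclideanSpace ℂ ι →L[ℝ] ℝ}

lemma smul_eq_re_im (c : ℂ) (x : EuclideanSpace ℂ ι) :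
    c • x = c.re • x + c.im • mulI ι x := by
  ext i
  simp only [PiLp.smul_apply, PiLp.add_apply, mulI_apply, smul_eq_mul, Complex.real_smul]
  conv_lhs => rw [← Complex.re_add_im c]
  ring

lemma leviForm_smul_left (c : ℂ) (x y : EuclideanSpace ℂ ι) :
    leviForm β (c • x) y = c * leviForm β x y := by
  rw [smul_eq_re_im]
  apply Complex.ext <;>
  simp [leviForm, mulI_mulI] <;> ring

lemma leviForm_smul_right (c : ℂ) (x y : EuclideanSpace ℂ ι) :
    leviForm β x (c • y) = conj c * leviForm β x y := by
  rw [smul_eq_re_im]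
  apply Complex.ext <;>
  simp [leviForm, mulI_mulI] <;> ring

lemma leviForm_sum_left {κ : Type*} (S : Finset κ) (x : κ → EuclideanSpace ℂ ι)
    (y : EuclideanSpace ℂ ι) : leviForm β (∑ s ∈ S, x s) y = ∑ s ∈ S, leviForm β (x s) y := by
  let L : EuclideanSpace ℂ ι →+ ℂ :=
    { toFun := fun x => leviForm β x y
      map_zero' := by simp [leviForm]
      map_add' := fun a b => by simp [leviForm]; ring }
  exact map_sum L x S

lemma leviForm_sum_right {κ : Type*} (S : Finset κ) (y : κ → EuclideanSpace ℂ ι)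
    (x : EuclideanSpace ℂ ι) : leviForm β x (∑ s ∈ S, y s) = ∑ s ∈ S, leviForm β x (y s) := by
  let L : EuclideanSpace ℂ ι →+ ℂ :=
    { toFun := fun y => leviForm β x y
      map_zero' := by simp [leviForm]
      map_add' := fun a b => by simp [leviForm]; ring }
  exact map_sum L y S

lemma leviForm_self_re (x : EuclideanSpace ℂ ι) :
    (leviForm β x x).re = β x x + β (mulI ι x) (mulI ι x) := by
  simp [leviForm]

variable [DecidableEq ι]

lemma mulI_single (s : ι) :
    mulI ι (EuclideanSpace.single s 1) = EuclideanSpace.single s Complex.I := by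
  ext i
  by_cases h : i = s <;> simp [mulI_apply, h]

lemma eq_sum_smul_single {𝕜 : Type*} [RCLike 𝕜] (x : EuclideanSpace 𝕜 ι) :
    x = ∑ s, x s • EuclideanSpace.single s (1 : 𝕜) := by
  ext i
  simp [Pi.single_apply]

lemma leviForm_expand (x y : EuclideanSpace ℂ ι) :
    leviForm β x y = ∑ s, ∑ t, x s * conj (y t)
      * leviForm β (EuclideanSpace.single s 1) (EuclideanSpace.single t 1) := by
  conv_lhs => rw [eq_sum_smul_single x, eq_sum_smul_single y]
  rw [leviForm_sum_left]
  refine Finset.sum_congr rfl fun s _ => ?_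
  rw [leviForm_sum_right]
  refine Finset.sum_congr rfl fun t _ => ?_
  rw [leviForm_smul_left, leviForm_smul_right]
  ring

lemma fderiv_ofReal {E : Type*} [NormedAddCommGroup E] [NormedSpace ℝ E] {u : E → ℝ} {z : E}
    (hu : DifferentiableAt ℝ u z) (v : E) :
    fderiv ℝ (fun y => ((u y : ℝ) : ℂ)) z v = (fderiv ℝ u z v : ℝ) := by
  have := (Complex.ofRealCLM.hasFDerivAt.comp z hu.hasFDerivAt).fderiv
  simp only [Function.comp_def, Complex.ofRealCLM_apply] at this
  rw [this]; rfl

lemma dz_ofReal {u : EuclideanSpace ℂ ι → ℝ} {z : EuclideanSpace ℂ ι}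
    (hu : DifferentiableAt ℝ u z) (s : ι) :
    dz s (fun y => ((u y : ℝ) : ℂ)) z = (1 / 2 : ℂ) * ((fderiv ℝ u z (EuclideanSpace.single s 1) : ℝ)
      - Complex.I * (fderiv ℝ u z (mulI ι (EuclideanSpace.single s 1)) : ℝ)) := by
  rw [dz, fderiv_ofReal hu, fderiv_ofReal hu, mulI_single]

lemma dzbar_ofReal {u : EuclideanSpace ℂ ι → ℝ} {z : EuclideanSpace ℂ ι}
    (hu : DifferentiableAt ℝ u z) (s : ι) :
    dzbar s (fun y => ((u y : ℝ) : ℂ)) z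
      = (1 / 2 : ℂ) * ((fderiv ℝ u z (EuclideanSpace.single s 1) : ℝ)
      + Complex.I * (fderiv ℝ u z (mulI ι (EuclideanSpace.single s 1)) : ℝ)) := by
  rw [dzbar, fderiv_ofReal hu, fderiv_ofReal hu, mulI_single]

lemma ContDiffAt.eventually_differentiableAt {E V : Type*} [NormedAddCommGroup E] [NormedSpace ℝ E]
    [NormedAddCommGroup V] [NormedSpace ℝ V] {u : E → V} {z : E}
    (hu : ContDiffAt ℝ ∞ u z) : ∀ᶠ y in nhds z, DifferentiableAt ℝ u y :=
  ((hu.of_le (by simp : (1 : WithTop ℕ∞) ≤ ∞)).eventually (by simp)).mono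
    fun _ hy => hy.differentiableAt (by simp)

/-- The factor 1/4 is the product of the two Wirtinger halves, which `leviForm` omits. -/
lemma dz_dzbar_ofReal {u : EuclideanSpace ℂ ι → ℝ} {z : EuclideanSpace ℂ ι}
    (hu : ContDiffAt ℝ ∞ u z) (s t : ι) :
    dz s (dzbar t (fun y => ((u y : ℝ) : ℂ))) z = (1 / 4 : ℂ) * leviForm (fderiv ℝ (fderiv ℝ u) z)
      (EuclideanSpace.single s 1) (EuclideanSpace.single t 1) := by
  have h1 : dzbar t (fun y => ((u y : ℝ) : ℂ)) =ᶠ[nhds z] fun y =>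
      (1 / 2 : ℂ) * ((fderiv ℝ u y (EuclideanSpace.single t 1) : ℝ)
      + Complex.I * (fderiv ℝ u y (mulI ι (EuclideanSpace.single t 1)) : ℝ)) := by
    filter_upwards [hu.eventually_differentiableAt] with y hy using dzbar_ofReal hy t
  have hc : ∀ w, DifferentiableAt ℝ (fun y => ((fderiv ℝ u y w : ℝ) : ℂ)) z := fun w =>
    Complex.ofRealCLM.differentiableAt.comp z (hu.fderiv_apply_infty w).differentiableAt_infty
  have h2 : ∀ v, fderiv ℝ (dzbar t (fun y => ((u y : ℝ) : ℂ))) z v = (1 / 2 : ℂ) *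
      ((fderiv ℝ (fderiv ℝ u) z v (EuclideanSpace.single t 1) : ℝ) + Complex.I *
        (fderiv ℝ (fderiv ℝ u) z v (mulI ι (EuclideanSpace.single t 1)) : ℝ)) := by
    intro v
    rw [h1.fderiv_eq, fderiv_const_mul ((hc _).fun_add ((hc _).const_mul _)), smul_apply,
      fderiv_fun_add (hc _) ((hc _).const_mul _), add_apply, fderiv_const_mul (hc _), smul_apply,
      fderiv_ofReal (hu.fderiv_apply_infty _).differentiableAt_infty,
      fderiv_ofReal (hu.fderiv_apply_infty _).differentiableAt_infty,
      fderiv_fderiv_apply hu, fderiv_fderiv_apply hu]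
    simp
  rw [dz, h2, h2, ← mulI_single, leviForm]
  push_cast
  ring_nf
  simp only [Complex.I_sq]
  ring

/-- If the Chern curvature has a positive eigenvalue, then `-log ρ` is strictly subharmonic on some
complex line. -/
lemma HasPositiveEigenvalue.exists_direction {ρ : EuclideanSpace ℂ ι → ℝ} {z : EuclideanSpace ℂ ι}
    (hρ : ContDiffAt ℝ ∞ ρ z) (h0 : ρ z ≠ 0)
    (h : HasPositiveEigenvalue (chernCurvature ρ z)) :
    ∃ v, fderiv ℝ (fderiv ℝ fun y => Real.log (ρ y)) z v v
      + fderiv ℝ (fderiv ℝ fun y => Real.log (ρ y)) z (mulI ι v) (mulI ι v) < 0 := by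
  obtain ⟨μ, hμ, hev⟩ := h
  obtain ⟨x, hx⟩ := hev.exists_hasEigenvector
  have hxe := hx.apply_eq_smul
  have hx0 := hx.2
  rw [Matrix.toLin'_apply] at hxe
  -- The eigenvector equation contracts the antiholomorphic index t with x, whereas `leviForm`
  -- conjugates its second argument; hence the conjugate of the eigenvector. The Levi form there is
  -- -4μ|x|².
  refine ⟨WithLp.toLp 2 fun s => conj (x s), ?_⟩
  rw [← leviForm_self_re, leviForm_expand]
  have hL : ∀ s t, leviForm (fderiv ℝ (fderiv ℝ fun y => Real.log (ρ y)) z)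
      (EuclideanSpace.single s 1) (EuclideanSpace.single t 1) = -4 * chernCurvature ρ z s t := by
    intro s t
    rw [chernCurvature, Matrix.of_apply, dz_dzbar_ofReal (hρ.log h0)]
    ring
  have hsum : ∑ s, ∑ t, conj (x s) * x t * (-4 * chernCurvature ρ z s t)
      = ((-4 * μ * ∑ s, Complex.normSq (x s) : ℝ) : ℂ) := by
    push_cast
    rw [Finset.mul_sum]
    refine Finset.sum_congr rfl fun s _ => ?_
    have h1 := congrFun hxe s
    simp only [Matrix.mulVec, dotProduct, Pi.smul_apply, smul_eq_mul] at h1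
    rw [Complex.normSq_eq_conj_mul_self]
    calc ∑ t, conj (x s) * x t * (-4 * chernCurvature ρ z s t)
        = -4 * conj (x s) * ∑ t, chernCurvature ρ z s t * x t := by
          rw [Finset.mul_sum]; exact Finset.sum_congr rfl fun t _ => by ring
      _ = _ := by rw [h1]; ring
  have e : (∑ s, ∑ t, (WithLp.toLp 2 fun s => conj (x s) : EuclideanSpace ℂ ι) s *
      conj ((WithLp.toLp 2 fun s => conj (x s) : EuclideanSpace ℂ ι) t) *
      leviForm (fderiv ℝ (fderiv ℝ fun y => Real.log (ρ y)) z)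
      (EuclideanSpace.single s 1) (EuclideanSpace.single t 1))
      = ((-4 * μ * ∑ s, Complex.normSq (x s) : ℝ) : ℂ) := by
    rw [← hsum]
    refine Finset.sum_congr rfl fun s _ => Finset.sum_congr rfl fun t _ => ?_
    rw [hL]; simp
  rw [e, Complex.ofReal_re]
  have hpos : 0 < ∑ s, Complex.normSq (x s) := by
    obtain ⟨s, hs⟩ := Function.ne_iff.1 hx0
    exact Finset.sum_pos' (fun i _ => Complex.normSq_nonneg _)
      ⟨s, Finset.mem_univ _, Complex.normSq_pos.2 hs⟩
  nlinarith

end Wirtinger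

/-- The second derivative is non-positive at a local maximum. -/
lemma IsLocalMax.fderiv_fderiv_nonpos {E : Type*} [NormedAddCommGroup E] [NormedSpace ℝ E]
    {u : E → ℝ} {z : E} (hu : ContDiffAt ℝ ∞ u z) (h : IsLocalMax u z) (v : E) :
    fderiv ℝ (fderiv ℝ u) z v v ≤ 0 := by
  by_contra! hpos
  let γ : ℝ → E := fun t => z + t • v
  have hγ : ∀ t, HasDerivAt γ v t := fun t => by
    simpa [γ] using ((hasDerivAt_id t).smul_const v).const_add z
  have hγc : Continuous γ := by fun_prop
  have hγ0 : γ 0 = z := by simp [γ]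
  have htend : Filter.Tendsto γ (nhds 0) (nhds z) := by
    have := hγc.tendsto 0
    rwa [hγ0] at this
  have hd : deriv (fun t => u (γ t)) =ᶠ[nhds 0] fun t => fderiv ℝ u (γ t) v := by
    filter_upwards [htend.eventually hu.eventually_differentiableAt] with t ht
    exact (ht.hasFDerivAt.comp_hasDerivAt t (hγ t)).deriv
  have hdd : deriv (deriv (fun t => u (γ t))) 0 = fderiv ℝ (fderiv ℝ u) z v v := by
    rw [hd.deriv_eq, ← fderiv_fderiv_apply hu, ← hγ0]
    have h1 : DifferentiableAt ℝ (fun y => fderiv ℝ u y v) (γ 0) := by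
      rw [hγ0]; exact (hu.fderiv_apply_infty v).differentiableAt_infty
    exact (h1.hasFDerivAt.comp_hasDerivAt 0 (hγ 0)).deriv
  have hmax : IsLocalMax (fun t => u (γ t)) 0 := by
    have := htend.eventually h
    simpa [IsLocalMax, IsMaxFilter, hγ0] using this
  have hcont : ContinuousAt (fun t => u (γ t)) 0 := by
    refine ContinuousAt.comp (g := u) ?_ hγc.continuousAt
    rw [hγ0]; exact hu.continuousAt
  -- A positive second derivative makes 0 a local minimum as well as a maximum. The function is then
  -- constant near 0, and its second derivative vanishes after all.
  have hmin := isLocalMin_of_deriv_deriv_pos (by rw [hdd]; exact hpos) hmax.deriv_eq_zero hcont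
  have hconst : (fun t => u (γ t)) =ᶠ[nhds 0] fun _ => u (γ 0) := by
    filter_upwards [hmax, hmin] with t h1 h2 using le_antisymm h1 h2
  have hd0 : deriv (fun t => u (γ t)) =ᶠ[nhds 0] deriv fun _ => u (γ 0) := hconst.deriv
  have := hd0.deriv_eq
  rw [hdd] at this
  simp at this
  exact hpos.ne' this

/-! ## The metric in a chart -/

section ChartDerivative

variable {𝕜 : Type*} [NontriviallyNormedField 𝕜] {E : Type*} [NormedAddCommGroup E]
  [NormedSpace 𝕜 E] {X : Type*} [TopologicalSpace X] [ChartedSpace E X] {k : WithTop ℕ∞}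
  {φ : OpenPartialHomeomorph X E}

lemma chart_mdifferentiable (hφ : φ ∈ IsManifold.maximalAtlas 𝓘(𝕜, E) k X) (hk : k ≠ 0) :
    φ.MDifferentiable 𝓘(𝕜, E) 𝓘(𝕜, E) :=
  ⟨(contMDiffOn_of_mem_maximalAtlas hφ).mdifferentiableOn hk,
    (contMDiffOn_symm_of_mem_maximalAtlas hφ).mdifferentiableOn hk⟩

end ChartDerivative

section Metric

variable {n : ℕ} {N : Type*} [TopologicalSpace N] [ChartedSpace (EuclideanSpace ℝ (Fin n)) N]
  [IsManifold 𝓘(ℝ, EuclideanSpace ℝ (Fin n)) ∞ N]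
  {g : SmoothRiemannianMetric (n := n) N}
  {ψ : OpenPartialHomeomorph N (EuclideanSpace ℝ (Fin n))}

/-- The coordinate field is the tangent map of the inverse chart applied to a constant section. It
is needed as a smooth section because `g` is given as a smooth section of a bundle of bilinear
forms, not by matrices. -/
lemma contMDiffAt_coordVector
    (hψ : ψ ∈ IsManifold.maximalAtlas 𝓘(ℝ, EuclideanSpace ℝ (Fin n)) ∞ N) (i : Fin n)
    {x : EuclideanSpace ℝ (Fin n)} (hx : x ∈ ψ.target) :
    ContMDiffAt 𝓘(ℝ, EuclideanSpace ℝ (Fin n)) 𝓘(ℝ, EuclideanSpace ℝ (Fin n)).tangent ∞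
      (fun y => (⟨ψ.symm y, coordVector ψ i y⟩ :
        TangentBundle 𝓘(ℝ, EuclideanSpace ℝ (Fin n)) N)) x := by
  have : IsManifold 𝓘(ℝ, EuclideanSpace ℝ (Fin n)) 1 N := IsManifold.of_le (n := ∞) (by simp)
  have h1 := (contMDiffOn_symm_of_mem_maximalAtlas hψ).contMDiffOn_tangentMapWithin
    (m := ∞) (by simp) ψ.open_target.uniqueMDiffOn
  have h2 : ContMDiffAt 𝓘(ℝ, EuclideanSpace ℝ (Fin n)) 𝓘(ℝ, EuclideanSpace ℝ (Fin n)).tangent ∞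
      (fun y => (⟨y, EuclideanSpace.single i (1 : ℝ)⟩ :
        TangentBundle 𝓘(ℝ, EuclideanSpace ℝ (Fin n)) (EuclideanSpace ℝ (Fin n)))) x :=
    contMDiffWithinAt_univ.1 ((contMDiffWithinAt_vectorSpace_iff_contDiffWithinAt
      (V := fun _ => EuclideanSpace.single i (1 : ℝ))).2 contDiffWithinAt_const)
  have h3 := h1 ⟨x, EuclideanSpace.single i (1 : ℝ)⟩ hx
  have h4 := (h3.comp (s := ψ.target) x h2.contMDiffWithinAt (fun y hy => hy)).contMDiffAt
    (ψ.open_target.mem_nhds hx)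
  refine h4.congr_of_eventuallyEq ?_
  filter_upwards [ψ.open_target.mem_nhds hx] with y hy
  simp only [Function.comp_apply, tangentMapWithin, coordVector]
  rw [mfderivWithin_of_isOpen ψ.open_target hy]

lemma contDiffAt_metricMatrix
    (hψ : ψ ∈ IsManifold.maximalAtlas 𝓘(ℝ, EuclideanSpace ℝ (Fin n)) ∞ N) (i j : Fin n)
    {x : EuclideanSpace ℝ (Fin n)} (hx : x ∈ ψ.target) :
    ContDiffAt ℝ ∞ (fun y => metricMatrix g ψ y i j) x := by
  have h1 := g.contMDiff.contMDiffAt.comp x (contMDiffAt_symm_of_mem_maximalAtlas hψ hx)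
  have h2 := ContMDiffAt.clm_bundle_apply₂ (F₃ := ℝ) (E₃ := Bundle.Trivial N ℝ) h1
    (contMDiffAt_coordVector hψ i hx) (contMDiffAt_coordVector hψ j hx)
  have h3 := (Bundle.contMDiffAt_totalSpace.1 h2).2
  exact h3.contDiffAt

/-- The metric in the chart `ψ` as a field of bilinear forms. -/
def metricBilin (g : SmoothRiemannianMetric (n := n) N)
    (ψ : OpenPartialHomeomorph N (EuclideanSpace ℝ (Fin n))) (x : EuclideanSpace ℝ (Fin n)) :
    EuclideanSpace ℝ (Fin n) →L[ℝ] EuclideanSpace ℝ (Fin n) →L[ℝ] ℝ :=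
  ∑ i, ∑ j, metricMatrix g ψ x i j • (EuclideanSpace.proj i :
    EuclideanSpace ℝ (Fin n) →L[ℝ] ℝ).smulRight (EuclideanSpace.proj j :
      EuclideanSpace ℝ (Fin n) →L[ℝ] ℝ)

lemma metricBilin_apply (x a b : EuclideanSpace ℝ (Fin n)) :
    metricBilin g ψ x a b = ∑ i, ∑ j, metricMatrix g ψ x i j * a i * b j := by
  simp [metricBilin, mul_assoc]

lemma metricBilin_single (x : EuclideanSpace ℝ (Fin n)) (i j : Fin n) :
    metricBilin g ψ x (EuclideanSpace.single i 1) (EuclideanSpace.single j 1)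
      = metricMatrix g ψ x i j := by
  simp [metricBilin_apply]

lemma bilin_ext {ι W : Type*} [Fintype ι] [DecidableEq ι] [NormedAddCommGroup W] [NormedSpace ℝ W]
    {β γ : EuclideanSpace ℝ ι →L[ℝ] W}
    (h : ∀ i, β (EuclideanSpace.single i 1) = γ (EuclideanSpace.single i 1)) : β = γ := by
  ext x
  rw [eq_sum_smul_single x]
  simp [map_sum, h]

/-- Both sides are bilinear and agree on basis vectors. The form is thus the pull-back of `g` by the
inverse chart, and inherits symmetry and positivity. -/
lemma metricBilin_eq_inner (x a b : EuclideanSpace ℝ (Fin n)) :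
    metricBilin g ψ x a b = g.inner (ψ.symm x)
      (mfderiv 𝓘(ℝ, EuclideanSpace ℝ (Fin n)) 𝓘(ℝ, EuclideanSpace ℝ (Fin n)) ψ.symm x a)
      (mfderiv 𝓘(ℝ, EuclideanSpace ℝ (Fin n)) 𝓘(ℝ, EuclideanSpace ℝ (Fin n)) ψ.symm x b) := by
  let D : EuclideanSpace ℝ (Fin n) →L[ℝ] EuclideanSpace ℝ (Fin n) :=
    mfderiv 𝓘(ℝ, EuclideanSpace ℝ (Fin n)) 𝓘(ℝ, EuclideanSpace ℝ (Fin n)) ψ.symm x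
  let B : EuclideanSpace ℝ (Fin n) →L[ℝ] EuclideanSpace ℝ (Fin n) →L[ℝ] ℝ := g.inner (ψ.symm x)
  have : metricBilin g ψ x = B.bilinearComp D D := by
    refine bilin_ext fun i => bilin_ext fun j => ?_
    rw [metricBilin_single]
    rfl
  rw [this]
  rfl

lemma metricMatrix_symm (x : EuclideanSpace ℝ (Fin n)) (i j : Fin n) :
    metricMatrix g ψ x i j = metricMatrix g ψ x j i := g.symm _ _ _

lemma metricBilin_symm (x a b : EuclideanSpace ℝ (Fin n)) :
    metricBilin g ψ x a b = metricBilin g ψ x b a := by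
  rw [metricBilin_eq_inner, metricBilin_eq_inner, g.symm]

lemma metricBilin_pos (hψ : ψ ∈ IsManifold.maximalAtlas 𝓘(ℝ, EuclideanSpace ℝ (Fin n)) ∞ N)
    {x : EuclideanSpace ℝ (Fin n)} (hx : x ∈ ψ.target) (a : EuclideanSpace ℝ (Fin n))
    (ha : a ≠ 0) : 0 < metricBilin g ψ x a a := by
  rw [metricBilin_eq_inner]
  refine g.pos _ _ ?_
  intro h
  have hinj := (chart_mdifferentiable hψ (by simp)).symm.mfderiv_injective hx
  exact ha (hinj (h.trans (map_zero _).symm))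

lemma contDiffAt_smul_const {E W : Type*} [NormedAddCommGroup E] [NormedSpace ℝ E]
    [NormedAddCommGroup W] [NormedSpace ℝ W] {u : E → ℝ} {x : E} (hu : ContDiffAt ℝ ∞ u x) (w : W) :
    ContDiffAt ℝ ∞ (fun y => u y • w) x :=
  hu.smul contDiffAt_const

lemma contDiffAt_metricBilin
    (hψ : ψ ∈ IsManifold.maximalAtlas 𝓘(ℝ, EuclideanSpace ℝ (Fin n)) ∞ N)
    {x : EuclideanSpace ℝ (Fin n)} (hx : x ∈ ψ.target) :
    ContDiffAt ℝ ∞ (metricBilin g ψ) x := by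
  unfold metricBilin
  exact ContDiffAt.sum fun i _ => ContDiffAt.sum fun j _ =>
    contDiffAt_smul_const (contDiffAt_metricMatrix hψ i j hx) _

/-- A non-zero vector in the kernel would have length zero. -/
lemma isUnit_det_metricMatrix
    (hψ : ψ ∈ IsManifold.maximalAtlas 𝓘(ℝ, EuclideanSpace ℝ (Fin n)) ∞ N)
    {x : EuclideanSpace ℝ (Fin n)} (hx : x ∈ ψ.target) : IsUnit (metricMatrix g ψ x).det := by
  rw [isUnit_iff_ne_zero]
  intro h
  obtain ⟨a, ha, ha0⟩ := Matrix.exists_mulVec_eq_zero_iff.2 h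
  have hpos := metricBilin_pos (g := g) hψ hx (WithLp.toLp 2 a) (by
    intro h0; exact ha (congrArg (WithLp.ofLp) h0))
  rw [metricBilin_apply] at hpos
  have : ∑ i, ∑ j, metricMatrix g ψ x i j * a i * a j
      = ∑ i, a i * (Matrix.mulVec (metricMatrix g ψ x) a) i := by
    refine Finset.sum_congr rfl fun i _ => ?_
    rw [Matrix.mulVec, dotProduct, Finset.mul_sum]
    exact Finset.sum_congr rfl fun j _ => by ring
  simp only [this, ha0] at hpos
  simp at hpos

lemma contDiffAt_det {E ι : Type*} [NormedAddCommGroup E] [NormedSpace ℝ E] [Fintype ι]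
    [DecidableEq ι] {A : E → Matrix ι ι ℝ} {x : E}
    (hA : ∀ i j, ContDiffAt ℝ ∞ (fun y => A y i j) x) : ContDiffAt ℝ ∞ (fun y => (A y).det) x := by
  simp only [Matrix.det_apply]
  exact ContDiffAt.sum fun σ _ => (contDiffAt_prod fun i _ => hA _ _).const_smul _

/-- By Cramer's rule each entry of the inverse is a quotient of determinants, and determinants are
polynomial in the entries. -/
lemma contDiffAt_matrix_inv {E ι : Type*} [NormedAddCommGroup E] [NormedSpace ℝ E] [Fintype ι]
    [DecidableEq ι] {A : E → Matrix ι ι ℝ} {x : E}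
    (hA : ∀ i j, ContDiffAt ℝ ∞ (fun y => A y i j) x) (h : IsUnit (A x).det) (i j : ι) :
    ContDiffAt ℝ ∞ (fun y => (A y)⁻¹ i j) x := by
  simp only [Matrix.inv_def, Ring.inverse_eq_inv, Matrix.smul_apply, smul_eq_mul,
    Matrix.adjugate_apply]
  refine ((contDiffAt_det hA).inv h.ne_zero).mul (contDiffAt_det fun k l => ?_)
  by_cases hk : k = j
  · subst hk
    simp only [Matrix.updateRow_self]
    exact contDiffAt_const
  · simp only [Matrix.updateRow_ne hk]
    exact hA k l

lemma contDiffAt_christoffel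
    (hψ : ψ ∈ IsManifold.maximalAtlas 𝓘(ℝ, EuclideanSpace ℝ (Fin n)) ∞ N) (i j k : Fin n)
    {x : EuclideanSpace ℝ (Fin n)} (hx : x ∈ ψ.target) :
    ContDiffAt ℝ ∞ (christoffel g ψ i j k) x := by
  have hp : ∀ a b c, ContDiffAt ℝ ∞ (partialDeriv a fun y => metricMatrix g ψ y b c) x :=
    fun a b c => (contDiffAt_metricMatrix hψ b c hx).fderiv_apply_infty _
  unfold christoffel
  exact contDiffAt_const.mul (ContDiffAt.sum fun l _ =>
    (contDiffAt_matrix_inv (fun a b => contDiffAt_metricMatrix hψ a b hx)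
      (isUnit_det_metricMatrix hψ hx) i l).mul (((hp j l k).add (hp k l j)).sub (hp l j k)))

lemma christoffel_symm (i j k : Fin n) : christoffel g ψ i j k = christoffel g ψ i k j := by
  funext x
  unfold christoffel
  congr 1
  refine Finset.sum_congr rfl fun l _ => ?_
  have : (fun y => metricMatrix g ψ y j k) = fun y => metricMatrix g ψ y k j :=
    funext fun y => metricMatrix_symm y j k
  rw [this]
  ring

/-- The Levi-Civita connection in the chart `ψ`. -/
def connBilin (g : SmoothRiemannianMetric (n := n) N)
    (ψ : OpenPartialHomeomorph N (EuclideanSpace ℝ (Fin n))) (x : EuclideanSpace ℝ (Fin n)) :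
    EuclideanSpace ℝ (Fin n) →L[ℝ] EuclideanSpace ℝ (Fin n) →L[ℝ] EuclideanSpace ℝ (Fin n) :=
  ∑ i, ∑ j, ∑ k, christoffel g ψ i j k x • (EuclideanSpace.proj j :
    EuclideanSpace ℝ (Fin n) →L[ℝ] ℝ).smulRight ((EuclideanSpace.proj k :
      EuclideanSpace ℝ (Fin n) →L[ℝ] ℝ).smulRight (EuclideanSpace.single i (1 : ℝ)))

lemma connBilin_apply (x a b : EuclideanSpace ℝ (Fin n)) (i : Fin n) :
    connBilin g ψ x a b i = ∑ j, ∑ k, christoffel g ψ i j k x * a j * b k := by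
  simp [connBilin, mul_assoc, Pi.single_apply]

lemma contDiffAt_connBilin
    (hψ : ψ ∈ IsManifold.maximalAtlas 𝓘(ℝ, EuclideanSpace ℝ (Fin n)) ∞ N)
    {x : EuclideanSpace ℝ (Fin n)} (hx : x ∈ ψ.target) :
    ContDiffAt ℝ ∞ (connBilin g ψ) x := by
  unfold connBilin
  exact ContDiffAt.sum fun i _ => ContDiffAt.sum fun j _ => ContDiffAt.sum fun k _ =>
    contDiffAt_smul_const (contDiffAt_christoffel hψ i j k hx) _

lemma connBilin_single (x : EuclideanSpace ℝ (Fin n)) (i j k : Fin n) :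
    connBilin g ψ x (EuclideanSpace.single j 1) (EuclideanSpace.single k 1) i
      = christoffel g ψ i j k x := by
  simp [connBilin_apply]

lemma connBilin_symm (x a b : EuclideanSpace ℝ (Fin n)) :
    connBilin g ψ x a b = connBilin g ψ x b a := by
  ext i
  rw [connBilin_apply, connBilin_apply, Finset.sum_comm]
  refine Finset.sum_congr rfl fun j _ => Finset.sum_congr rfl fun k _ => ?_
  rw [christoffel_symm]; ring

/-- The Christoffel symbols of the first kind. -/
lemma metricBilin_connBilin
    (hψ : ψ ∈ IsManifold.maximalAtlas 𝓘(ℝ, EuclideanSpace ℝ (Fin n)) ∞ N)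
    {x : EuclideanSpace ℝ (Fin n)} (hx : x ∈ ψ.target) (j k l : Fin n) :
    metricBilin g ψ x (connBilin g ψ x (EuclideanSpace.single j 1) (EuclideanSpace.single k 1))
      (EuclideanSpace.single l 1)
      = (1 / 2 : ℝ) * (partialDeriv j (fun y => metricMatrix g ψ y l k) x
      + partialDeriv k (fun y => metricMatrix g ψ y l j) x
      - partialDeriv l (fun y => metricMatrix g ψ y j k) x) := by
  rw [metricBilin_symm, metricBilin_apply]
  simp only [connBilin_single]
  have h1 : ∑ i, ∑ p, metricMatrix g ψ x i p *
        (EuclideanSpace.single l (1 : ℝ) : EuclideanSpace ℝ (Fin n)) i * christoffel g ψ p j k x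
      = ∑ p, metricMatrix g ψ x l p * christoffel g ψ p j k x := by
    simp
  rw [h1]
  set c : Fin n → ℝ := fun l => partialDeriv j (fun y => metricMatrix g ψ y l k) x
      + partialDeriv k (fun y => metricMatrix g ψ y l j) x
      - partialDeriv l (fun y => metricMatrix g ψ y j k) x with hc
  have h2 : ∀ p, christoffel g ψ p j k x
      = (1 / 2 : ℝ) * (Matrix.mulVec (metricMatrix g ψ x)⁻¹ c) p := fun p => rfl
  simp only [h2]
  have h3 : ∑ p, metricMatrix g ψ x l p * ((1 / 2 : ℝ) * (Matrix.mulVec (metricMatrix g ψ x)⁻¹ c) p)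
      = (1 / 2 : ℝ) * (Matrix.mulVec (metricMatrix g ψ x)
        (Matrix.mulVec (metricMatrix g ψ x)⁻¹ c)) l := by
    rw [Matrix.mulVec, dotProduct, Finset.mul_sum]
    exact Finset.sum_congr rfl fun p _ => by ring
  rw [h3, Matrix.mulVec_mulVec, Matrix.mul_nonsing_inv _ (isUnit_det_metricMatrix hψ hx),
    Matrix.one_mulVec]

lemma fderiv_metricBilin_single
    (hψ : ψ ∈ IsManifold.maximalAtlas 𝓘(ℝ, EuclideanSpace ℝ (Fin n)) ∞ N)
    {x : EuclideanSpace ℝ (Fin n)} (hx : x ∈ ψ.target) (k i j : Fin n) :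
    fderiv ℝ (metricBilin g ψ) x (EuclideanSpace.single k 1) (EuclideanSpace.single i 1)
      (EuclideanSpace.single j 1) = partialDeriv k (fun y => metricMatrix g ψ y i j) x := by
  have h := (contDiffAt_metricBilin (g := g) hψ hx).differentiableAt_infty.hasFDerivAt
  have h1 := ((h.clm_apply (hasFDerivAt_const (EuclideanSpace.single i (1 : ℝ)) x)).clm_apply
    (hasFDerivAt_const (EuclideanSpace.single j (1 : ℝ)) x)).fderiv
  simp only [metricBilin_single] at h1
  rw [partialDeriv, h1]
  simp

/-- In a chart, the metric is parallel for the connection given by the Christoffel symbols. -/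
theorem isLeviCivitaOn_chart
    (hψ : ψ ∈ IsManifold.maximalAtlas 𝓘(ℝ, EuclideanSpace ℝ (Fin n)) ∞ N) :
    IsLeviCivitaOn (metricBilin g ψ) (connBilin g ψ) ψ.target where
  isOpen := ψ.open_target
  smooth_metric _ hx := contDiffAt_metricBilin hψ hx
  smooth_connection _ hx := contDiffAt_connBilin hψ hx
  symm x _ := metricBilin_symm x
  pos _ hx := metricBilin_pos hψ hx
  torsion_free x _ := connBilin_symm x
  compat := by
    intro x hx a b c
    have main : ∀ k i j : Fin n,
        fderiv ℝ (metricBilin g ψ) x (EuclideanSpace.single k 1) (EuclideanSpace.single i 1)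
          (EuclideanSpace.single j 1)
        = metricBilin g ψ x (connBilin g ψ x (EuclideanSpace.single k 1)
            (EuclideanSpace.single i 1)) (EuclideanSpace.single j 1)
          + metricBilin g ψ x (EuclideanSpace.single i 1) (connBilin g ψ x
            (EuclideanSpace.single k 1) (EuclideanSpace.single j 1)) := by
      intro k i j
      rw [metricBilin_symm x (EuclideanSpace.single i 1), metricBilin_connBilin hψ hx,
        metricBilin_connBilin hψ hx, fderiv_metricBilin_single hψ hx]
      have e : ∀ a b, (fun y => metricMatrix g ψ y a b) = fun y => metricMatrix g ψ y b a :=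
        fun a b => funext fun y => metricMatrix_symm y a b
      rw [e j i, e j k, e i k]
      ring
    set G := metricBilin g ψ x
    set Γ := connBilin g ψ x
    set D := fderiv ℝ (metricBilin g ψ) x
    -- The identity extends from basis vectors to arbitrary vectors one slot at a time: first the
    -- third, then the second, then the first.
    have h1 : ∀ k i, D (EuclideanSpace.single k 1) (EuclideanSpace.single i 1)
        = G (Γ (EuclideanSpace.single k 1) (EuclideanSpace.single i 1))
          + (G (EuclideanSpace.single i 1)).comp (Γ (EuclideanSpace.single k 1)) := fun k i =>
      bilin_ext fun j => main k i j
    have h2 : ∀ k, (D (EuclideanSpace.single k 1)).flip c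
        = (G.flip c).comp (Γ (EuclideanSpace.single k 1))
          + G.flip (Γ (EuclideanSpace.single k 1) c) := fun k =>
      bilin_ext fun i => by simp [h1]
    have h3 : (D.flip b).flip c = (G.flip c).comp (Γ.flip b) + (G b).comp (Γ.flip c) :=
      bilin_ext fun k => by simpa using congrArg (fun L => L b) (h2 k)
    simpa using congrArg (fun L => L a) h3

end Metric

/-! ## Sectional curvature in a chart -/

section SectionalCurvature

section Linear

variable {V : Type*} [NormedAddCommGroup V] [NormedSpace ℝ V] {Γ : V → V →L[ℝ] V →L[ℝ] V}
  {κ : Type*}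

lemma curvOp_sum_left (x : V) (S : Finset κ) (r : κ → ℝ) (a : κ → V) (b c : V) :
    curvOp Γ x (∑ i ∈ S, r i • a i) b c = ∑ i ∈ S, r i • curvOp Γ x (a i) b c := by
  let L : V →ₗ[ℝ] V :=
    { toFun := fun a => curvOp Γ x a b c
      map_add' := fun p q => by simp only [curvOp, map_add, add_apply]; abel
      map_smul' := fun t p => by
        simp only [curvOp, map_smul, smul_apply, smul_sub, smul_add, RingHom.id_apply] }
  exact (map_sum L _ S).trans (Finset.sum_congr rfl fun i _ => map_smul L _ _)

lemma curvOp_sum_middle (x : V) (S : Finset κ) (r : κ → ℝ) (a : κ → V) (b c : V) :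
    curvOp Γ x b (∑ i ∈ S, r i • a i) c = ∑ i ∈ S, r i • curvOp Γ x b (a i) c := by
  rw [IsLeviCivitaOn.curvOp_swap, curvOp_sum_left, ← Finset.sum_neg_distrib]
  refine Finset.sum_congr rfl fun i _ => ?_
  rw [IsLeviCivitaOn.curvOp_swap x b (a i)]
  simp

lemma curvOp_sum_right (x : V) (S : Finset κ) (r : κ → ℝ) (a : κ → V) (b c : V) :
    curvOp Γ x b c (∑ i ∈ S, r i • a i) = ∑ i ∈ S, r i • curvOp Γ x b c (a i) := by
  let L : V →ₗ[ℝ] V :=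
    { toFun := fun a => curvOp Γ x b c a
      map_add' := fun p q => IsLeviCivitaOn.curvOp_add_right x b c p q
      map_smul' := fun t p => by
        simp only [curvOp, map_smul, smul_sub, smul_add, RingHom.id_apply] }
  exact (map_sum L _ S).trans (Finset.sum_congr rfl fun i _ => map_smul L _ _)

lemma curvOp_smul_left (x : V) (t : ℝ) (a b c : V) :
    curvOp Γ x (t • a) b c = t • curvOp Γ x a b c := by
  simpa using curvOp_sum_left (Γ := Γ) x {()} (fun _ => t) (fun _ => a) b c

end Linear

variable {n : ℕ} {N : Type*} [TopologicalSpace N] [ChartedSpace (EuclideanSpace ℝ (Fin n)) N]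
  [IsManifold 𝓘(ℝ, EuclideanSpace ℝ (Fin n)) ∞ N]
  {g : SmoothRiemannianMetric (n := n) N}
  {ψ : OpenPartialHomeomorph N (EuclideanSpace ℝ (Fin n))}

lemma fderiv_connBilin_single
    (hψ : ψ ∈ IsManifold.maximalAtlas 𝓘(ℝ, EuclideanSpace ℝ (Fin n)) ∞ N)
    {x : EuclideanSpace ℝ (Fin n)} (hx : x ∈ ψ.target) (i j k l : Fin n) :
    fderiv ℝ (connBilin g ψ) x (EuclideanSpace.single i 1) (EuclideanSpace.single j 1)
      (EuclideanSpace.single k 1) l = partialDeriv i (christoffel g ψ l k j) x := by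
  have h := (contDiffAt_connBilin (g := g) hψ hx).differentiableAt_infty.hasFDerivAt
  have h1 := (h.clm_apply (hasFDerivAt_const (EuclideanSpace.single j (1 : ℝ)) x)).clm_apply
    (hasFDerivAt_const (EuclideanSpace.single k (1 : ℝ)) x)
  have h2 := ((EuclideanSpace.proj l : EuclideanSpace ℝ (Fin n) →L[ℝ] ℝ).hasFDerivAt.comp x
    h1).fderiv
  have e : (⇑(EuclideanSpace.proj l : EuclideanSpace ℝ (Fin n) →L[ℝ] ℝ) ∘ fun y =>
      connBilin g ψ y (EuclideanSpace.single j 1) (EuclideanSpace.single k 1))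
      = christoffel g ψ l k j := by
    funext y
    rw [christoffel_symm]
    exact connBilin_single y l j k
  rw [e] at h2
  rw [partialDeriv, h2]
  simp

/-- `curvatureUp` writes the lower Christoffel indices in the opposite order to `curvOp`; the
symmetry of the symbols reconciles them. -/
lemma curvOp_single (hψ : ψ ∈ IsManifold.maximalAtlas 𝓘(ℝ, EuclideanSpace ℝ (Fin n)) ∞ N)
    {x : EuclideanSpace ℝ (Fin n)} (hx : x ∈ ψ.target) (i j k l : Fin n) :
    curvOp (connBilin g ψ) x (EuclideanSpace.single i 1) (EuclideanSpace.single j 1)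
      (EuclideanSpace.single k 1) l = curvatureUp g ψ i j k l x := by
  have h : ∀ a b c, connBilin g ψ x (EuclideanSpace.single a 1)
      (connBilin g ψ x (EuclideanSpace.single b 1) (EuclideanSpace.single c 1)) l
      = ∑ p, christoffel g ψ p c b x * christoffel g ψ l p a x := by
    intro a b c
    rw [connBilin_apply, Finset.sum_comm]
    refine Finset.sum_congr rfl fun p _ => ?_
    rw [connBilin_single, christoffel_symm p b c, christoffel_symm l p a]
    simp [mul_comm]
  rw [curvatureUp, Finset.sum_sub_distrib, ← h, ← h, ← fderiv_connBilin_single hψ hx,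
    ← fderiv_connBilin_single hψ hx]
  simp only [curvOp, PiLp.sub_apply, PiLp.add_apply]
  ring

lemma metricBilin_curvOp_single
    (hψ : ψ ∈ IsManifold.maximalAtlas 𝓘(ℝ, EuclideanSpace ℝ (Fin n)) ∞ N)
    {x : EuclideanSpace ℝ (Fin n)} (hx : x ∈ ψ.target) (i j k l : Fin n) :
    metricBilin g ψ x (curvOp (connBilin g ψ) x (EuclideanSpace.single i 1)
      (EuclideanSpace.single j 1) (EuclideanSpace.single k 1)) (EuclideanSpace.single l 1)
      = curvatureDown g ψ i j k l x := by
  rw [metricBilin_apply, curvatureDown]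
  refine Finset.sum_congr rfl fun s _ => ?_
  rw [curvOp_single hψ hx]
  simp

lemma metricBilin_curvOp
    (hψ : ψ ∈ IsManifold.maximalAtlas 𝓘(ℝ, EuclideanSpace ℝ (Fin n)) ∞ N)
    {x : EuclideanSpace ℝ (Fin n)} (hx : x ∈ ψ.target) (a b c d : EuclideanSpace ℝ (Fin n)) :
    metricBilin g ψ x (curvOp (connBilin g ψ) x a b c) d
      = ∑ i, ∑ j, ∑ k, ∑ l, curvatureDown g ψ i j k l x * a i * b j * c k * d l := by
  conv_lhs => rw [eq_sum_smul_single a, eq_sum_smul_single b, eq_sum_smul_single c]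
  rw [curvOp_sum_left, map_sum, sum_apply]
  refine Finset.sum_congr rfl fun i _ => ?_
  rw [curvOp_sum_middle, Finset.smul_sum, map_sum, sum_apply]
  refine Finset.sum_congr rfl fun j _ => ?_
  rw [curvOp_sum_right, Finset.smul_sum, Finset.smul_sum, map_sum, sum_apply]
  refine Finset.sum_congr rfl fun k _ => ?_
  conv_lhs => rw [eq_sum_smul_single d]
  rw [map_sum]
  refine Finset.sum_congr rfl fun l _ => ?_
  simp only [map_smul, smul_apply, smul_eq_mul, metricBilin_curvOp_single hψ hx]
  ring

/-- By skew-symmetry this is minus the numerator of the sectional curvature. For dependent vectors,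
where the quotient is not controlled by the hypothesis, the expression vanishes. -/
lemma curvOp_nonneg_of_nonposSectionalCurvature (hN : NonposSectionalCurvature g)
    (hψ : ψ ∈ IsManifold.maximalAtlas 𝓘(ℝ, EuclideanSpace ℝ (Fin n)) ∞ N)
    {x : EuclideanSpace ℝ (Fin n)} (hx : x ∈ ψ.target) (a b : EuclideanSpace ℝ (Fin n)) :
    0 ≤ metricBilin g ψ x (curvOp (connBilin g ψ) x a b a) b := by
  have h := isLeviCivitaOn_chart (g := g) hψ
  have hself : ∀ c d, curvOp (connBilin g ψ) x c c d = 0 := by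
    intro c d
    simp [curvOp]
  by_cases hli : LinearIndependent ℝ ![(a : Fin n → ℝ), (b : Fin n → ℝ)]
  · have hK := hN ψ hψ x hx _ _ hli
    rw [sectionalCurvature, ← metricBilin_curvOp hψ hx a b b a] at hK
    have hm : ∀ c d : EuclideanSpace ℝ (Fin n),
        metricForm g ψ x c d = metricBilin g ψ x c d := fun c d => (metricBilin_apply x c d).symm
    rw [hm, hm, hm] at hK
    set G := metricBilin g ψ x with hG
    have hb : b ≠ 0 := by
      intro hb
      have := hli.ne_zero 1
      simp [hb] at this
    -- This vector is G(b,b) times the component of `a` orthogonal to `b`. Its squared length is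
    -- G(b,b) times the Gram determinant, so the denominator of the sectional curvature is positive.
    have hz : G b b • a - G a b • b ≠ 0 := by
      intro hz
      have h1 := LinearIndependent.pair_iff.1 hli (G b b) (-G a b) (by
        have := congrArg (WithLp.ofLp) hz
        simpa [sub_eq_add_neg] using this)
      exact (h.pos x hx b hb).ne' h1.1
    have hpos := h.pos x hx _ hz
    have e : G (G b b • a - G a b • b) (G b b • a - G a b • b)
        = G b b * (G a a * G b b - G a b ^ 2) := by
      have hs : G b a = G a b := h.symm x hx b a
      simp only [map_sub, map_smul, sub_apply, smul_apply, smul_eq_mul, hs]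
      ring
    rw [← hG, e] at hpos
    have hden := (mul_pos_iff_of_pos_left (h.pos x hx b hb)).1 hpos
    have hnum : G (curvOp (connBilin g ψ) x a b b) a ≤ 0 := by
      by_contra! hcon
      exact absurd (div_pos hcon hden) (not_lt.2 hK)
    rw [hG, h.curvOp_skew hx]
    linarith
  · rw [LinearIndependent.pair_iff] at hli
    push Not at hli
    obtain ⟨s, t, hst, hne⟩ := hli
    have hst' : s • a + t • b = 0 := by
      ext i
      exact congrFun hst i
    by_cases hs : s = 0
    · have hb : b = 0 := by
        rw [hs] at hst'
        simpa [hne hs] using hst'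
      simp [hb]
    · have ha : a = (-(t / s)) • b := by
        have h1 : s • a = -(t • b) := eq_neg_of_add_eq_zero_left hst'
        calc a = s⁻¹ • s • a := by rw [smul_smul, inv_mul_cancel₀ hs, one_smul]
          _ = _ := by rw [h1, smul_neg, smul_smul, neg_smul]; congr 2; ring
      have : curvOp (connBilin g ψ) x a b a = 0 := by
        conv_lhs => rw [ha]
        rw [curvOp_smul_left, hself, smul_zero]
      simp [this]

/-! ## The pluriharmonic equation in a chart -/

lemma leviForm_eq_zero {ι : Type*} [Fintype ι] [DecidableEq ι]
    {β : EuclideanSpace ℂ ι →L[ℝ] EuclideanSpace ℂ ι →L[ℝ] ℝ}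
    (h : ∀ s t, leviForm β (EuclideanSpace.single s 1) (EuclideanSpace.single t 1) = 0)
    (v w : EuclideanSpace ℂ ι) : β (mulI ι v) (mulI ι w) = -β v w := by
  have h1 : leviForm β v w = 0 := by
    rw [leviForm_expand]
    simp [h]
  have h2 := congrArg Complex.re h1
  simp [leviForm] at h2
  linarith

lemma fderiv_coord {E : Type*} [NormedAddCommGroup E] [NormedSpace ℝ E]
    {H : E → EuclideanSpace ℝ (Fin n)} {y : E} (hH : DifferentiableAt ℝ H y) (i : Fin n) (v : E) :
    fderiv ℝ (fun y => H y i) y v = fderiv ℝ H y v i := by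
  have := ((EuclideanSpace.proj i : EuclideanSpace ℝ (Fin n) →L[ℝ] ℝ).hasFDerivAt.comp y
    hH.hasFDerivAt).fderiv
  have e : fderiv ℝ (fun y => H y i) y = _ := this
  rw [e]; rfl

/-- Each component of the Hessian is a real bilinear form whose Levi form on coordinate vectors is
four times the left side of the pluri-harmonic equation. So the Levi form vanishes, and its real
part is the claim. -/
lemma covHess_mulI {m : ℕ} {F : EuclideanSpace ℂ (Fin m) → EuclideanSpace ℝ (Fin n)}
    {z : EuclideanSpace ℂ (Fin m)} (hF : ContDiffAt ℝ ∞ F z)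
    (heq : ∀ (α β : Fin m) (i : Fin n),
      dz α (dzbar β (fun y => ((F y i : ℝ) : ℂ))) z
        + ∑ j, ∑ k, (christoffel g ψ i j k (F z) : ℂ)
            * dzbar β (fun y => ((F y j : ℝ) : ℂ)) z * dz α (fun y => ((F y k : ℝ) : ℂ)) z = 0)
    (v w : EuclideanSpace ℂ (Fin m)) :
    covHess (connBilin g ψ) F (mulI _ v) (mulI _ w) z = -covHess (connBilin g ψ) F v w z := by
  set D := fderiv ℝ F z with hD
  ext i
  let p : EuclideanSpace ℝ (Fin n) →L[ℝ] ℝ := EuclideanSpace.proj i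
  let β : EuclideanSpace ℂ (Fin m) →L[ℝ] EuclideanSpace ℂ (Fin m) →L[ℝ] ℝ :=
    (ContinuousLinearMap.compL ℝ _ _ _ p).comp
      (fderiv ℝ (fderiv ℝ F) z + (connBilin g ψ (F z)).bilinearComp D D)
  have hβ : ∀ v w, β v w = fderiv ℝ (fderiv ℝ F) z v w i + connBilin g ψ (F z) (D v) (D w) i :=
    fun v w => rfl
  have hcov : ∀ v w, covHess (connBilin g ψ) F v w z i = β v w := by
    intro v w
    rw [covHess_eq hF, hβ]; rfl
  rw [PiLp.neg_apply, hcov, hcov]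
  refine leviForm_eq_zero (fun s t => ?_) v w
  have hFi : ∀ i, ContDiffAt ℝ ∞ (fun y => F y i) z := fun i =>
    (EuclideanSpace.proj i : EuclideanSpace ℝ (Fin n) →L[ℝ] ℝ).contDiff.contDiffAt.comp z hF
  have d2 : ∀ v w, fderiv ℝ (fderiv ℝ fun y => F y i) z v w
      = fderiv ℝ (fderiv ℝ F) z v w i := by
    intro v w
    have h1 : (fun y => fderiv ℝ (fun y => F y i) y w) =ᶠ[nhds z] fun y => fderiv ℝ F y w i := by
      filter_upwards [hF.eventually_differentiableAt] with y hy using fderiv_coord hy i w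
    rw [← fderiv_fderiv_apply (hFi i), ← fderiv_fderiv_apply hF, h1.fderiv_eq,
      fderiv_coord (hF.fderiv_apply_infty w).differentiableAt_infty]
  have key := heq s t i
  rw [dz_dzbar_ofReal (hFi i)] at key
  simp only [dz_ofReal (hFi _).differentiableAt_infty, dzbar_ofReal (hFi _).differentiableAt_infty,
    fderiv_coord hF.differentiableAt_infty, ← hD] at key
  simp only [leviForm, d2] at key
  simp only [leviForm, hβ]
  set a := EuclideanSpace.single s (1 : ℂ)
  set b := EuclideanSpace.single t (1 : ℂ)
  set Γ := connBilin g ψ (F z) with hΓ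
  -- The equation puts the antiholomorphic derivative in the first slot of the Christoffel symbols,
  -- the Levi form in the second; the symmetry of the connection is what matches them.
  have S : ∑ j, ∑ k, (christoffel g ψ i j k (F z) : ℂ)
        * ((1 / 2 : ℂ) * ((D b j : ℝ) + Complex.I * (D (mulI _ b) j : ℝ)))
        * ((1 / 2 : ℂ) * ((D a k : ℝ) - Complex.I * (D (mulI _ a) k : ℝ)))
      = (1 / 4 : ℂ) * ((Γ (D a) (D b) i + Γ (D (mulI _ a)) (D (mulI _ b)) i : ℝ)
        + Complex.I * (Γ (D a) (D (mulI _ b)) i - Γ (D (mulI _ a)) (D b) i : ℝ)) := by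
    rw [hΓ, connBilin_symm _ (D a), connBilin_symm _ (D (mulI _ a)), connBilin_symm _ (D a),
      connBilin_symm _ (D (mulI _ a))]
    simp only [connBilin_apply, Complex.ofReal_add, Complex.ofReal_sub, Complex.ofReal_sum,
      Complex.ofReal_mul, ← Finset.sum_add_distrib, ← Finset.sum_sub_distrib, Finset.mul_sum]
    refine Finset.sum_congr rfl fun j _ => Finset.sum_congr rfl fun k _ => ?_
    ring_nf
    simp only [Complex.I_sq]
    ring
  rw [S] at key
  push_cast at key ⊢
  linear_combination 4 * key

end SectionalCurvature

/-! ## Maps from complex manifolds -/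

section RestrictScalars

variable {m : ℕ} {X Y : Type*} [TopologicalSpace X] [ChartedSpace (EuclideanSpace ℂ (Fin m)) X]
  [TopologicalSpace Y] [ChartedSpace (EuclideanSpace ℂ (Fin m)) Y]

lemma ContMDiffAt.restrictScalars_real {k : WithTop ℕ∞} {f : X → Y} {x : X}
    (h : ContMDiffAt 𝓘(ℂ, EuclideanSpace ℂ (Fin m)) 𝓘(ℂ, EuclideanSpace ℂ (Fin m)) k f x) :
    ContMDiffAt 𝓘(ℝ, EuclideanSpace ℂ (Fin m)) 𝓘(ℝ, EuclideanSpace ℂ (Fin m)) k f x := by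
  rw [contMDiffAt_iff] at h ⊢
  exact ⟨h.1, h.2.restrict_scalars ℝ⟩

lemma HasMFDerivAt.restrictScalars_real {f : X → Y} {x : X}
    {f' : EuclideanSpace ℂ (Fin m) →L[ℂ] EuclideanSpace ℂ (Fin m)}
    (h : HasMFDerivAt 𝓘(ℂ, EuclideanSpace ℂ (Fin m)) 𝓘(ℂ, EuclideanSpace ℂ (Fin m)) f x f') :
    HasMFDerivAt 𝓘(ℝ, EuclideanSpace ℂ (Fin m)) 𝓘(ℝ, EuclideanSpace ℂ (Fin m)) f x
      (f'.restrictScalars ℝ) :=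
  ⟨h.1, HasFDerivWithinAt.restrictScalars ℝ h.2⟩

end RestrictScalars

section CoordMap

section Domain

variable {X Y E V : Type*} [TopologicalSpace X] [TopologicalSpace Y] [TopologicalSpace E]
  [TopologicalSpace V]

/-- The domain in the chart `φ` of the coordinate expression of `f`. -/
def mapDomain (φ : OpenPartialHomeomorph X E)
    (ψ : OpenPartialHomeomorph Y V) (f : X → Y) :
    Set E :=
  φ.target ∩ (fun z => f (φ.symm z)) ⁻¹' ψ.source

lemma isOpen_mapDomain {φ : OpenPartialHomeomorph X E} {ψ : OpenPartialHomeomorph Y V} {f : X → Y}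
    (hf : Continuous f) : IsOpen (mapDomain φ ψ f) :=
  (hf.comp_continuousOn φ.continuousOn_symm).isOpen_inter_preimage φ.open_target ψ.open_source

end Domain

variable {m n : ℕ} {M : Type*} [TopologicalSpace M] [ChartedSpace (EuclideanSpace ℂ (Fin m)) M]
  {N : Type*} [TopologicalSpace N] [ChartedSpace (EuclideanSpace ℝ (Fin n)) N]
  {ψ : OpenPartialHomeomorph N (EuclideanSpace ℝ (Fin n))}
  {φ : OpenPartialHomeomorph M (EuclideanSpace ℂ (Fin m))} {f : M → N}

/-- The differential of `f : M → N` at `p` as a real linear map between the model spaces. -/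
def realDeriv (f : M → N) (p : M) : EuclideanSpace ℂ (Fin m) →L[ℝ] EuclideanSpace ℝ (Fin n) :=
  mfderiv 𝓘(ℝ, EuclideanSpace ℂ (Fin m)) 𝓘(ℝ, EuclideanSpace ℝ (Fin n)) f p

/-- The derivative of the inverse of a holomorphic chart. -/
def chartSymmDeriv (φ : OpenPartialHomeomorph M (EuclideanSpace ℂ (Fin m)))
    (z : EuclideanSpace ℂ (Fin m)) : EuclideanSpace ℂ (Fin m) →L[ℂ] EuclideanSpace ℂ (Fin m) :=
  mfderiv 𝓘(ℂ, EuclideanSpace ℂ (Fin m)) 𝓘(ℂ, EuclideanSpace ℂ (Fin m)) φ.symm z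

lemma contMDiffAt_symm_real
    (hφ : φ ∈ IsManifold.maximalAtlas 𝓘(ℂ, EuclideanSpace ℂ (Fin m)) ω M)
    {z : EuclideanSpace ℂ (Fin m)} (hz : z ∈ φ.target) :
    ContMDiffAt 𝓘(ℝ, EuclideanSpace ℂ (Fin m)) 𝓘(ℝ, EuclideanSpace ℂ (Fin m)) ∞ φ.symm z :=
  (contMDiffAt_symm_of_mem_maximalAtlas hφ hz).restrictScalars_real.of_le le_top

lemma contDiffAt_coordMap
    (hφ : φ ∈ IsManifold.maximalAtlas 𝓘(ℂ, EuclideanSpace ℂ (Fin m)) ω M)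
    (hψ : ψ ∈ IsManifold.maximalAtlas 𝓘(ℝ, EuclideanSpace ℝ (Fin n)) ∞ N)
    (hf : ContMDiff 𝓘(ℝ, EuclideanSpace ℂ (Fin m)) 𝓘(ℝ, EuclideanSpace ℝ (Fin n)) ∞ f)
    {z : EuclideanSpace ℂ (Fin m)} (hz : z ∈ mapDomain φ ψ f) :
    ContDiffAt ℝ ∞ (fun y => ψ (f (φ.symm y))) z := by
  have h1 := (hf.contMDiffAt (x := φ.symm z)).comp z (contMDiffAt_symm_real hφ hz.1)
  have h2 : ContMDiffAt 𝓘(ℝ, EuclideanSpace ℝ (Fin n)) 𝓘(ℝ, EuclideanSpace ℝ (Fin n)) ∞ ψ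
      (f (φ.symm z)) :=
    (contMDiffOn_of_mem_maximalAtlas hψ).contMDiffAt (ψ.open_source.mem_nhds hz.2)
  exact (h2.comp z h1).contDiffAt

lemma fderiv_coordMap
    (hφ : φ ∈ IsManifold.maximalAtlas 𝓘(ℂ, EuclideanSpace ℂ (Fin m)) ω M)
    (hψ : ψ ∈ IsManifold.maximalAtlas 𝓘(ℝ, EuclideanSpace ℝ (Fin n)) ∞ N)
    (hf : ContMDiff 𝓘(ℝ, EuclideanSpace ℂ (Fin m)) 𝓘(ℝ, EuclideanSpace ℝ (Fin n)) ∞ f)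
    {z : EuclideanSpace ℂ (Fin m)} (hz : z ∈ mapDomain φ ψ f) (v : EuclideanSpace ℂ (Fin m)) :
    fderiv ℝ (fun y => ψ (f (φ.symm y))) z v
      = mfderiv 𝓘(ℝ, EuclideanSpace ℝ (Fin n)) 𝓘(ℝ, EuclideanSpace ℝ (Fin n)) ψ (f (φ.symm z))
        (realDeriv f (φ.symm z) (chartSymmDeriv φ z v)) := by
  have h0 : HasMFDerivAt 𝓘(ℂ, EuclideanSpace ℂ (Fin m)) 𝓘(ℂ, EuclideanSpace ℂ (Fin m)) φ.symm z
      (chartSymmDeriv φ z) :=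
    ((chart_mdifferentiable hφ (by simp)).mdifferentiableAt_symm hz.1).hasMFDerivAt
  have h1 := (hf.mdifferentiableAt (by simp) (x := φ.symm z)).hasMFDerivAt
  have h2 := ((chart_mdifferentiable hψ (by simp)).mdifferentiableAt hz.2).hasMFDerivAt
  have h3 := (h2.comp z (h1.comp z h0.restrictScalars_real)).hasFDerivAt
  let D : EuclideanSpace ℝ (Fin n) →L[ℝ] EuclideanSpace ℝ (Fin n) :=
    mfderiv 𝓘(ℝ, EuclideanSpace ℝ (Fin n)) 𝓘(ℝ, EuclideanSpace ℝ (Fin n)) ψ (f (φ.symm z))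
  have h4 : HasFDerivAt (fun y => ψ (f (φ.symm y)))
    (D.comp ((realDeriv f (φ.symm z)).comp ((chartSymmDeriv φ z).restrictScalars ℝ))) z := h3
  rw [h4.fderiv]
  rfl

lemma chartSymmDeriv_mulI (z v : EuclideanSpace ℂ (Fin m)) :
    chartSymmDeriv φ z (mulI _ v) = mulI _ (chartSymmDeriv φ z v) := by
  simp only [mulI_apply, map_smul]

end CoordMap

/-! ### The energy density of a map as a function of tangent vectors -/

section MapEnergy

variable {m n : ℕ} {M : Type*} [TopologicalSpace M] [ChartedSpace (EuclideanSpace ℂ (Fin m)) M]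
  {N : Type*} [TopologicalSpace N] [ChartedSpace (EuclideanSpace ℝ (Fin n)) N]
  [IsManifold 𝓘(ℝ, EuclideanSpace ℝ (Fin n)) ∞ N]
  {g : SmoothRiemannianMetric (n := n) N}
  {ψ : OpenPartialHomeomorph N (EuclideanSpace ℝ (Fin n))}
  {φ : OpenPartialHomeomorph M (EuclideanSpace ℂ (Fin m))} {f : M → N}

/-- The scalar product of `g` at `q` on the model space. -/
def innerAt (g : SmoothRiemannianMetric (n := n) N) (q : N) :
    EuclideanSpace ℝ (Fin n) →L[ℝ] EuclideanSpace ℝ (Fin n) →L[ℝ] ℝ :=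
  g.inner q

/-- Four times the squared length of `∂f(v)`. -/
def mapEnergy (g : SmoothRiemannianMetric (n := n) N) (f : M → N) (p : M)
    (v : EuclideanSpace ℂ (Fin m)) : ℝ :=
  innerAt g (f p) (realDeriv f p v) (realDeriv f p v)
    + innerAt g (f p) (realDeriv f p (mulI _ v)) (realDeriv f p (mulI _ v))

lemma innerAt_symm (q : N) (a b : EuclideanSpace ℝ (Fin n)) :
    innerAt g q a b = innerAt g q b a := g.symm q a b

lemma innerAt_pos (q : N) {a : EuclideanSpace ℝ (Fin n)} (ha : a ≠ 0) : 0 < innerAt g q a a :=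
  g.pos q a ha

lemma innerAt_nonneg (q : N) (a : EuclideanSpace ℝ (Fin n)) : 0 ≤ innerAt g q a a := by
  by_cases ha : a = 0
  · simp [ha]
  · exact (innerAt_pos q ha).le

/-- For c = s + it the cross terms of |df(sv + tJv)|² and |df(sJv - tv)|² cancel. This is the same
homogeneity as that of `tautologicalNormSq`. -/
lemma mapEnergy_smul (p : M) (c : ℂ) (v : EuclideanSpace ℂ (Fin m)) :
    mapEnergy g f p (c • v) = Complex.normSq c * mapEnergy g f p v := by
  rw [smul_eq_re_im]
  simp only [mapEnergy, map_add, map_smul, mulI_mulI, map_neg, add_apply, smul_apply, smul_eq_mul,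
    neg_apply, smul_neg, Complex.normSq_apply,
    innerAt_symm _ (realDeriv f p (mulI (Fin m) v)) (realDeriv f p v)]
  ring

lemma realDeriv_eq_zero_of_mapEnergy {p : M} {v : EuclideanSpace ℂ (Fin m)}
    (h : mapEnergy g f p v ≤ 0) : realDeriv (n := n) f p v = 0 := by
  by_contra hne
  have h1 := innerAt_pos (g := g) (f p) hne
  have h2 := innerAt_nonneg (g := g) (f p) (realDeriv f p (mulI _ v))
  unfold mapEnergy at h
  linarith

lemma metricBilin_mfderiv
    (hψ : ψ ∈ IsManifold.maximalAtlas 𝓘(ℝ, EuclideanSpace ℝ (Fin n)) ∞ N) {q : N}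
    (hq : q ∈ ψ.source) (a b : EuclideanSpace ℝ (Fin n)) :
    metricBilin g ψ (ψ q)
      (mfderiv 𝓘(ℝ, EuclideanSpace ℝ (Fin n)) 𝓘(ℝ, EuclideanSpace ℝ (Fin n)) ψ q a)
      (mfderiv 𝓘(ℝ, EuclideanSpace ℝ (Fin n)) 𝓘(ℝ, EuclideanSpace ℝ (Fin n)) ψ q b)
      = innerAt g q a b := by
  have hd := (chart_mdifferentiable hψ (by simp)).symm_comp_deriv hq
  have e : ∀ c : EuclideanSpace ℝ (Fin n),
      mfderiv 𝓘(ℝ, EuclideanSpace ℝ (Fin n)) 𝓘(ℝ, EuclideanSpace ℝ (Fin n)) ψ.symm (ψ q)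
      (mfderiv 𝓘(ℝ, EuclideanSpace ℝ (Fin n)) 𝓘(ℝ, EuclideanSpace ℝ (Fin n)) ψ q c) = c :=
    fun c => congrArg (fun L => L c) hd
  refine (metricBilin_eq_inner (g := g) (ψ := ψ) (ψ q) _ _).trans ?_
  have t : ∀ q', q' = q → ∀ x y : EuclideanSpace ℝ (Fin n), innerAt g q' x y = innerAt g q x y := by
    rintro _ rfl _ _; rfl
  have := t _ (ψ.left_inv hq) a b
  rw [← this]
  exact congrArg₂ (fun x y => innerAt g (ψ.symm (ψ q)) x y) (e a) (e b)

/-- The energy is defined without charts so that it can be maximised over all of M; here it meets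
the local theory. The chart of N is an isometry onto `metricBilin`, and the derivative of the
holomorphic chart commutes with i. -/
lemma mapEnergy_chart
    (hφ : φ ∈ IsManifold.maximalAtlas 𝓘(ℂ, EuclideanSpace ℂ (Fin m)) ω M)
    (hψ : ψ ∈ IsManifold.maximalAtlas 𝓘(ℝ, EuclideanSpace ℝ (Fin n)) ∞ N)
    (hf : ContMDiff 𝓘(ℝ, EuclideanSpace ℂ (Fin m)) 𝓘(ℝ, EuclideanSpace ℝ (Fin n)) ∞ f)
    {z : EuclideanSpace ℂ (Fin m)} (hz : z ∈ mapDomain φ ψ f) (v : EuclideanSpace ℂ (Fin m)) :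
    mapEnergy g f (φ.symm z) (chartSymmDeriv φ z v)
      = metricBilin g ψ (ψ (f (φ.symm z))) (fderiv ℝ (fun y => ψ (f (φ.symm y))) z v)
          (fderiv ℝ (fun y => ψ (f (φ.symm y))) z v)
        + metricBilin g ψ (ψ (f (φ.symm z))) (fderiv ℝ (fun y => ψ (f (φ.symm y))) z (mulI _ v))
          (fderiv ℝ (fun y => ψ (f (φ.symm y))) z (mulI _ v)) := by
  rw [fderiv_coordMap hφ hψ hf hz, fderiv_coordMap hφ hψ hf hz, chartSymmDeriv_mulI]
  exact (congrArg₂ (· + ·) (metricBilin_mfderiv hψ hz.2 _ _)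
    (metricBilin_mfderiv hψ hz.2 _ _)).symm

variable [IsManifold 𝓘(ℂ, EuclideanSpace ℂ (Fin m)) ω M]

lemma IsPluriharmonic.isPluriharmonicOn_chart (hf : IsPluriharmonic (m := m) g f)
    (hφ : φ ∈ IsManifold.maximalAtlas 𝓘(ℂ, EuclideanSpace ℂ (Fin m)) ω M)
    (hψ : ψ ∈ IsManifold.maximalAtlas 𝓘(ℝ, EuclideanSpace ℝ (Fin n)) ∞ N) :
    IsPluriharmonicOn (connBilin g ψ) ψ.target (mulI _) (fun y => ψ (f (φ.symm y)))
      (mapDomain φ ψ f) where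
  isOpen := isOpen_mapDomain hf.smooth.continuous
  smooth _ hz := contDiffAt_coordMap hφ hψ hf.smooth hz
  mapsTo _ hz := ψ.map_source hz.2
  sq := mulI_mulI
  hess z hz := covHess_mulI (contDiffAt_coordMap hφ hψ hf.smooth hz)
    (hf.equation φ hφ ψ hψ z hz.1 hz.2)

/-- A smooth map on a connected manifold with vanishing differential is constant. -/
lemma eq_of_realDeriv_eq_zero [PreconnectedSpace M]
    (hf : ContMDiff 𝓘(ℝ, EuclideanSpace ℂ (Fin m)) 𝓘(ℝ, EuclideanSpace ℝ (Fin n)) ∞ f)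
    (h : ∀ p (v : EuclideanSpace ℂ (Fin m)), realDeriv (n := n) f p v = 0) (p q : M) : f p = f q := by
  have hloc : IsLocallyConstant f := by
    rw [IsLocallyConstant.iff_eventually_eq]
    intro p
    let φ := chartAt (EuclideanSpace ℂ (Fin m)) p
    let ψ := chartAt (EuclideanSpace ℝ (Fin n)) (f p)
    have hφ : φ ∈ IsManifold.maximalAtlas 𝓘(ℂ, EuclideanSpace ℂ (Fin m)) ω M :=
      IsManifold.chart_mem_maximalAtlas p
    have hψ : ψ ∈ IsManifold.maximalAtlas 𝓘(ℝ, EuclideanSpace ℝ (Fin n)) ∞ N :=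
      IsManifold.chart_mem_maximalAtlas (f p)
    have hp : p ∈ φ.source := mem_chart_source _ p
    have hz : φ p ∈ mapDomain φ ψ f := by
      refine ⟨φ.map_source hp, ?_⟩
      change f (φ.symm (φ p)) ∈ ψ.source
      rw [φ.left_inv hp]
      exact mem_chart_source _ (f p)
    obtain ⟨r, hr, hball⟩ := Metric.isOpen_iff.1
      (isOpen_mapDomain (φ := φ) (ψ := ψ) hf.continuous) _ hz
    have hconst : ∀ y ∈ Metric.ball (φ p) r, ψ (f (φ.symm y)) = ψ (f (φ.symm (φ p))) := by
      intro y hy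
      refine Metric.isOpen_ball.is_const_of_fderiv_eq_zero (𝕜 := ℝ)
        (f := fun y => ψ (f (φ.symm y))) (convex_ball (φ p) r).isPreconnected ?_ ?_ hy
        (Metric.mem_ball_self hr)
      · exact fun w hw => (contDiffAt_coordMap hφ hψ hf
          (hball hw)).differentiableAt_infty.differentiableWithinAt
      · intro w hw
        ext1 v
        rw [fderiv_coordMap hφ hψ hf (hball hw), h]
        exact map_zero _
    have hnear : ∀ᶠ q in nhds p, φ q ∈ Metric.ball (φ p) r :=
      (φ.continuousAt hp).eventually (Metric.ball_mem_nhds _ hr)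
    filter_upwards [hnear, φ.open_source.mem_nhds hp] with q hq hqs
    have h1 := hconst _ hq
    have h2 := (hball hq).2
    rw [φ.left_inv hqs, φ.left_inv hp] at h1
    change f (φ.symm (φ q)) ∈ ψ.source at h2
    rw [φ.left_inv hqs] at h2
    exact ψ.injOn h2 (mem_chart_source _ (f p)) h1
  exact hloc.apply_eq_of_preconnectedSpace p q

end MapEnergy

/-! ## Local coordinates on the projective bundle -/

section FiberCoordinates

variable {m : ℕ} {a : Fin m}

/-- `baseCoord` as a real linear map. -/
def baseCoordL (a : Fin m) : EuclideanSpace ℂ (Fin m ⊕ {i : Fin m // i ≠ a}) →L[ℝ]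
    EuclideanSpace ℂ (Fin m) :=
  (LinearMap.toContinuousLinearMap (𝕜 := ℂ)
    { toFun := baseCoord
      map_add' := fun _ _ => rfl
      map_smul' := fun _ _ => rfl }).restrictScalars ℝ

/-- The linear part of `fiberCoord`. -/
def fiberCoordL (a : Fin m) : EuclideanSpace ℂ (Fin m ⊕ {i : Fin m // i ≠ a}) →L[ℝ]
    EuclideanSpace ℂ (Fin m) :=
  (LinearMap.toContinuousLinearMap (𝕜 := ℂ)
    { toFun := fun ζ : EuclideanSpace ℂ (Fin m ⊕ {i : Fin m // i ≠ a}) =>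
        (WithLp.toLp 2 fun i => if h : i ≠ a then ζ (Sum.inr ⟨i, h⟩) else 0 :
          EuclideanSpace ℂ (Fin m))
      map_add' := fun x y => by ext i; by_cases h : i = a <;> simp [h]
      map_smul' := fun c x => by ext i; by_cases h : i = a <;> simp [h] }).restrictScalars ℝ

lemma fiberCoord_eq (ζ : EuclideanSpace ℂ (Fin m ⊕ {i : Fin m // i ≠ a})) :
    fiberCoord ζ = fiberCoordL a ζ + EuclideanSpace.single a 1 := by
  ext i
  by_cases h : i = a
  · subst h; simp [fiberCoord, fiberCoordL]
  · simp [fiberCoord, fiberCoordL, h]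

lemma baseCoordL_mulI (ζ : EuclideanSpace ℂ (Fin m ⊕ {i : Fin m // i ≠ a})) :
    baseCoordL a (mulI _ ζ) = mulI _ (baseCoordL a ζ) := rfl

lemma fiberCoordL_mulI (ζ : EuclideanSpace ℂ (Fin m ⊕ {i : Fin m // i ≠ a})) :
    fiberCoordL a (mulI _ ζ) = mulI _ (fiberCoordL a ζ) := by
  ext i
  by_cases h : i = a <;> simp [fiberCoordL, mulI_apply, h]

lemma fiberCoord_ne_zero (ζ : EuclideanSpace ℂ (Fin m ⊕ {i : Fin m // i ≠ a})) :
    fiberCoord ζ ≠ 0 := by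
  intro h
  have := congrArg (fun v => v a) h
  simp [fiberCoord] at this

/-- Every non-zero vector is a multiple of one whose homogeneous coordinates are normalised and
bounded. -/
lemma exists_fiberCoord (z w : EuclideanSpace ℂ (Fin m)) (hw : w ≠ 0) :
    ∃ (a : Fin m) (ζ : EuclideanSpace ℂ (Fin m ⊕ {i : Fin m // i ≠ a})) (c : ℂ), c ≠ 0 ∧
      baseCoord ζ = z ∧ (∀ i, ‖ζ (Sum.inr i)‖ ≤ 1) ∧ w = c • fiberCoord ζ := by
  obtain ⟨i₀, hi₀⟩ : ∃ i, w i ≠ 0 := by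
    by_contra! h
    exact hw (by ext i; simpa using h i)
  -- Dividing by a coordinate of largest modulus keeps the others in the closed unit disc. This is
  -- what makes the fibres compact.
  obtain ⟨a, -, ha⟩ := Finset.exists_max_image Finset.univ (fun i => ‖w i‖) ⟨i₀, Finset.mem_univ _⟩
  have hwa : w a ≠ 0 := by
    intro h
    have := ha i₀ (Finset.mem_univ _)
    rw [h, norm_zero] at this
    exact hi₀ (norm_le_zero_iff.1 this)
  refine ⟨a, WithLp.toLp 2 (Sum.elim (fun i => z i) fun i => w i / w a), w a, hwa, ?_, ?_, ?_⟩
  · ext i; simp [baseCoord]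
  · intro i
    simp only [Sum.elim_inr, norm_div]
    exact div_le_one_of_le₀ (ha _ (Finset.mem_univ _)) (norm_nonneg _)
  · ext i
    by_cases h : i = a
    · subst h; simp [fiberCoord]
    · simp [fiberCoord, h]; field_simp

lemma continuous_baseCoord : Continuous (baseCoord (a := a)) :=
  (baseCoordL a).continuous

lemma isOpen_projChartTarget {M : Type*} [TopologicalSpace M]
    (φ : OpenPartialHomeomorph M (EuclideanSpace ℂ (Fin m)))
    (a : Fin m) :
    IsOpen (projChartTarget φ a) :=
  φ.open_target.preimage continuous_baseCoord

end FiberCoordinates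

/-! ### Hermitian metrics on the tautological line bundle -/

section TautologicalNorm

variable {m : ℕ} {M : Type*} [TopologicalSpace M] [ChartedSpace (EuclideanSpace ℂ (Fin m)) M]
  {φ : OpenPartialHomeomorph M (EuclideanSpace ℂ (Fin m))}

variable (H : ∀ x : ProjTangent (m := m) M, InnerProductSpace.Core ℂ x.tautologicalFiber)

/-- A non-zero vector lies on only one line, so the fibre can be named by any representative. This
allows v and cv to be compared inside one and the same fibre. -/
lemma tautologicalNormSq_eq (p : M)
    (l : Projectivization ℂ (TangentSpace 𝓘(ℂ, EuclideanSpace ℂ (Fin m)) p))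
    (v : TangentSpace 𝓘(ℂ, EuclideanSpace ℂ (Fin m)) p) (hv : v ≠ 0)
    (hx : v ∈ ProjTangent.tautologicalFiber (m := m) (M := M) ⟨p, l⟩) :
    tautologicalNormSq H p v = ((H ⟨p, l⟩).inner ⟨v, hx⟩ ⟨v, hx⟩).re := by
  have hl : l = Projectivization.mk ℂ v hv := by
    induction l using Projectivization.ind with
    | h w hw =>
      change v ∈ (Projectivization.mk ℂ w hw).submodule at hx
      rw [Projectivization.submodule_mk] at hx
      obtain ⟨c, hc⟩ := Submodule.mem_span_singleton.1 hx
      exact ((Projectivization.mk_eq_mk_iff' ℂ _ _ _ _).2 ⟨c, hc⟩).symm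
  subst hl
  rw [tautologicalNormSq]
  exact dif_pos hv

lemma mem_tautologicalFiber_mk (p : M) (v : TangentSpace 𝓘(ℂ, EuclideanSpace ℂ (Fin m)) p) (hv : v ≠ 0) (c : ℂ) :
    c • v ∈ ProjTangent.tautologicalFiber (m := m) (M := M)
      ⟨p, Projectivization.mk ℂ v hv⟩ := by
  change c • v ∈ (Projectivization.mk ℂ v hv).submodule
  rw [Projectivization.submodule_mk]
  exact Submodule.smul_mem _ _ (Submodule.mem_span_singleton_self _)

lemma tautologicalNormSq_smul (p : M) (v : TangentSpace 𝓘(ℂ, EuclideanSpace ℂ (Fin m)) p) (hv : v ≠ 0) {c : ℂ}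
    (hc : c ≠ 0) : tautologicalNormSq H p (c • v) = Complex.normSq c * tautologicalNormSq H p v := by
  set x : ProjTangent (m := m) M :=
    ⟨p, Projectivization.mk ℂ v hv⟩ with hx
  have h1 := mem_tautologicalFiber_mk p v hv c
  have h2 : v ∈ x.tautologicalFiber := by simpa using mem_tautologicalFiber_mk p v hv 1
  have e1 := tautologicalNormSq_eq H p _ (c • v) (smul_ne_zero hc hv) h1
  have e2 := tautologicalNormSq_eq H p _ v hv h2
  have e3 : (⟨c • v, h1⟩ : x.tautologicalFiber) = c • ⟨v, h2⟩ := rfl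
  refine e1.trans (Eq.trans ?_ (congrArg (Complex.normSq c * ·) e2.symm))
  rw [e3]
  have i1 : (H x).inner (c • ⟨v, h2⟩) (c • ⟨v, h2⟩)
      = conj c * (c * (H x).inner ⟨v, h2⟩ ⟨v, h2⟩) := by
    rw [(H x).smul_left, ← (H x).conj_inner_symm, (H x).smul_left, map_mul, (H x).conj_inner_symm,
      Complex.conj_conj]
  rw [i1, ← mul_assoc, ← Complex.normSq_eq_conj_mul_self, Complex.re_ofReal_mul]

lemma tautologicalNormSq_pos (p : M) (v : TangentSpace 𝓘(ℂ, EuclideanSpace ℂ (Fin m)) p) (hv : v ≠ 0) :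
    0 < tautologicalNormSq H p v := by
  set x : ProjTangent (m := m) M :=
    ⟨p, Projectivization.mk ℂ v hv⟩ with hx
  have h2 : v ∈ x.tautologicalFiber := by simpa using mem_tautologicalFiber_mk p v hv 1
  have e2 := tautologicalNormSq_eq H p _ v hv h2
  refine lt_of_lt_of_eq ?_ e2.symm
  refine lt_of_le_of_ne ((H x).re_inner_nonneg _) fun h0 => ?_
  -- Definiteness asks for the complex number ⟨v,v⟩ to vanish; Hermitian symmetry takes care of its
  -- imaginary part.
  have him : ((H x).inner ⟨v, h2⟩ ⟨v, h2⟩).im = 0 := by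
    have := congrArg Complex.im ((H x).conj_inner_symm ⟨v, h2⟩ ⟨v, h2⟩)
    simp at this
    linarith
  have := (H x).definite ⟨v, h2⟩ (Complex.ext h0.symm him)
  exact hv (congrArg Subtype.val this)

end TautologicalNorm

/-! ### Compactness of the projective bundle -/

section Maximum

variable {m : ℕ} {M : Type*} [TopologicalSpace M] [ChartedSpace (EuclideanSpace ℂ (Fin m)) M]
  {φ : OpenPartialHomeomorph M (EuclideanSpace ℂ (Fin m))}

lemma chartSymmDeriv_injective
    (hφ : φ ∈ IsManifold.maximalAtlas 𝓘(ℂ, EuclideanSpace ℂ (Fin m)) ω M)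
    {z : EuclideanSpace ℂ (Fin m)} (hz : z ∈ φ.target) :
    Function.Injective (chartSymmDeriv φ z) :=
  (chart_mdifferentiable hφ (by simp)).symm.mfderiv_injective hz

lemma chartSymmDeriv_surjective
    (hφ : φ ∈ IsManifold.maximalAtlas 𝓘(ℂ, EuclideanSpace ℂ (Fin m)) ω M)
    {z : EuclideanSpace ℂ (Fin m)} (hz : z ∈ φ.target) :
    Function.Surjective (chartSymmDeriv φ z) :=
  (chart_mdifferentiable hφ (by simp)).symm.mfderiv_surjective hz

/-- Every tangent direction is represented by bounded local coordinates of the projective bundle. -/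
lemma exists_tautologicalSection
    (hφ : φ ∈ IsManifold.maximalAtlas 𝓘(ℂ, EuclideanSpace ℂ (Fin m)) ω M)
    {z : EuclideanSpace ℂ (Fin m)} (hz : z ∈ φ.target) (v : EuclideanSpace ℂ (Fin m))
    (hv : v ≠ 0) :
    ∃ (a : Fin m) (ζ : EuclideanSpace ℂ (Fin m ⊕ {i : Fin m // i ≠ a})) (c : ℂ), c ≠ 0 ∧
      baseCoord ζ = z ∧ (∀ i, ‖ζ (Sum.inr i)‖ ≤ 1) ∧
      v = c • chartSymmDeriv φ (baseCoord ζ) (fiberCoord ζ) := by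
  obtain ⟨w, rfl⟩ := chartSymmDeriv_surjective hφ hz v
  have hw : w ≠ 0 := by rintro rfl; exact hv (map_zero _)
  obtain ⟨a, ζ, c, hc, rfl, hb, hwc⟩ := exists_fiberCoord z w hw
  refine ⟨a, ζ, c, hc, rfl, hb, ?_⟩
  rw [← map_smul, ← hwc]

variable [IsManifold 𝓘(ℂ, EuclideanSpace ℂ (Fin m)) ω M]

/-- A function on `P(T_M)` which is continuous in the local coordinates has a maximum if `M` is
compact. -/
lemma exists_max_projTangent [CompactSpace M] (u : M → EuclideanSpace ℂ (Fin m) → ℝ)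
    (hu : ∀ p v (c : ℂ), v ≠ 0 → c ≠ 0 → u p (c • v) = u p v)
    (hcont : ∀ φ ∈ IsManifold.maximalAtlas 𝓘(ℂ, EuclideanSpace ℂ (Fin m)) ω M, ∀ a : Fin m,
      ContinuousOn (fun ζ => u (φ.symm (baseCoord ζ))
        (chartSymmDeriv φ (baseCoord ζ) (fiberCoord ζ))) (projChartTarget φ a))
    (hne : Nonempty M) (hm : 0 < m) :
    ∃ φ ∈ IsManifold.maximalAtlas 𝓘(ℂ, EuclideanSpace ℂ (Fin m)) ω M, ∃ a : Fin m,
      ∃ ζ ∈ projChartTarget φ a, ∀ p v, v ≠ 0 →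
        u p v ≤ u (φ.symm (baseCoord ζ)) (chartSymmDeriv φ (baseCoord ζ) (fiberCoord ζ)) := by
  have hM : ∃ (p₀ : M) (v₀ : EuclideanSpace ℂ (Fin m)), v₀ ≠ 0 ∧
      ∀ p ∈ (Set.univ : Set M), ∀ v, v ≠ 0 → u p v ≤ u p₀ v₀ := by
    -- The property of `s` is that one value of `u` dominates all values over `s`. The dominating
    -- point need not lie over `s`, so the property passes to subsets and finite unions, and no
    -- topology on P(T_M) is needed.
    refine isCompact_univ.induction_on (p := fun s => ∃ (p₀ : M) (v₀ : EuclideanSpace ℂ (Fin m)),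
      v₀ ≠ 0 ∧ ∀ p ∈ s, ∀ v, v ≠ 0 → u p v ≤ u p₀ v₀) ?_ ?_ ?_ ?_
    · refine ⟨hne.some, EuclideanSpace.single ⟨0, hm⟩ 1, ?_, by simp⟩
      simp
    · rintro s t hst ⟨p₀, v₀, h0, h⟩
      exact ⟨p₀, v₀, h0, fun p hp => h p (hst hp)⟩
    · rintro s t ⟨p₀, v₀, h0, h⟩ ⟨p₁, v₁, h1, h'⟩
      rcases le_total (u p₀ v₀) (u p₁ v₁) with hle | hle
      · refine ⟨p₁, v₁, h1, ?_⟩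
        rintro p (hp | hp) v hv
        · exact (h p hp v hv).trans hle
        · exact h' p hp v hv
      · refine ⟨p₀, v₀, h0, ?_⟩
        rintro p (hp | hp) v hv
        · exact h p hp v hv
        · exact (h' p hp v hv).trans hle
    · intro q _
      let φ := chartAt (EuclideanSpace ℂ (Fin m)) q
      have hφ : φ ∈ IsManifold.maximalAtlas 𝓘(ℂ, EuclideanSpace ℂ (Fin m)) ω M :=
        IsManifold.chart_mem_maximalAtlas q
      have hq : q ∈ φ.source := mem_chart_source _ q
      obtain ⟨r, hr, hball⟩ := Metric.nhds_basis_closedBall.mem_iff.1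
        (φ.open_target.mem_nhds (φ.map_source hq))
      -- The sets `K a` are compact, and for varying `a` they represent all lines over a closed
      -- coordinate ball. The largest of their finitely many maxima dominates `u` there.
      let K : ∀ a : Fin m, Set (EuclideanSpace ℂ (Fin m ⊕ {i : Fin m // i ≠ a})) := fun a =>
        {ζ | baseCoord ζ ∈ Metric.closedBall (φ q) r ∧ ∀ i, ‖ζ (Sum.inr i)‖ ≤ 1}
      have hKc : ∀ a, IsCompact (K a) := by
        intro a
        refine Metric.isCompact_of_isClosed_isBounded ?_ ?_
        · have : K a = baseCoord ⁻¹' Metric.closedBall (φ q) r ∩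
              ⋂ i, {ζ : EuclideanSpace ℂ (Fin m ⊕ {i : Fin m // i ≠ a}) |
                ‖ζ (Sum.inr i)‖ ≤ 1} := by
            ext ζ
            simp [K]
          rw [this]
          exact (Metric.isClosed_closedBall.preimage continuous_baseCoord).inter
            (isClosed_iInter fun i => isClosed_le (by fun_prop) continuous_const)
        · refine (Metric.isBounded_closedBall (x := (0 : EuclideanSpace ℂ (Fin m ⊕
            {i : Fin m // i ≠ a}))) (r := Real.sqrt ((‖φ q‖ + r) ^ 2 + Fintype.card
            {i : Fin m // i ≠ a}))).subset ?_
          rintro ζ ⟨hζ1, hζ2⟩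
          rw [mem_closedBall_zero_iff, EuclideanSpace.norm_eq]
          refine Real.sqrt_le_sqrt ?_
          rw [Fintype.sum_sum_type]
          refine add_le_add ?_ ?_
          · have h1 : ‖baseCoord ζ‖ ≤ ‖φ q‖ + r := by
              have := norm_le_norm_add_norm_sub' (baseCoord ζ) (φ q)
              rw [mem_closedBall_iff_norm] at hζ1
              linarith
            have h2 := EuclideanSpace.norm_sq_eq (baseCoord ζ)
            calc _ = ‖baseCoord ζ‖ ^ 2 := h2.symm
              _ ≤ _ := by gcongr
          · calc ∑ i, ‖ζ (Sum.inr i)‖ ^ 2 ≤ ∑ _i : {i : Fin m // i ≠ a}, (1 : ℝ) :=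
                  Finset.sum_le_sum fun i _ => pow_le_one₀ (norm_nonneg _) (hζ2 i)
              _ = _ := by simp
      have hKn : ∀ a, (K a).Nonempty := fun a =>
        ⟨WithLp.toLp 2 (Sum.elim (fun i => φ q i) 0), by
          constructor
          · have : baseCoord (a := a) (WithLp.toLp 2 (Sum.elim (fun i => φ q i) 0)) = φ q := by
              ext i; simp [baseCoord]
            rw [this]
            exact Metric.mem_closedBall_self hr.le
          · simp⟩
      have hKt : ∀ a, K a ⊆ projChartTarget φ a := fun a ζ hζ => hball hζ.1
      choose ζ hζ hmax using fun a =>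
        (hKc a).exists_isMaxOn (hKn a) ((hcont φ hφ a).mono (hKt a))
      obtain ⟨a, -, ha⟩ := Finset.exists_max_image Finset.univ
        (fun a => u (φ.symm (baseCoord (ζ a)))
          (chartSymmDeriv φ (baseCoord (ζ a)) (fiberCoord (ζ a)))) ⟨⟨0, hm⟩, Finset.mem_univ _⟩
      refine ⟨φ.source ∩ φ ⁻¹' Metric.closedBall (φ q) r, ?_, φ.symm (baseCoord (ζ a)),
        chartSymmDeriv φ (baseCoord (ζ a)) (fiberCoord (ζ a)), ?_, ?_⟩
      · refine mem_nhdsWithin_of_mem_nhds (Filter.inter_mem (φ.open_source.mem_nhds hq) ?_)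
        exact (φ.continuousAt hq).preimage_mem_nhds (Metric.closedBall_mem_nhds _ hr)
      · intro h0
        exact fiberCoord_ne_zero (ζ a)
          (chartSymmDeriv_injective hφ (hKt a (hζ a)) (h0.trans (map_zero _).symm))
      · rintro p ⟨hps, hpb⟩ v hv
        obtain ⟨b, ξ, c, hc, hbase, hbd, rfl⟩ :=
          exists_tautologicalSection hφ (φ.map_source hps) v hv
        have h0 : chartSymmDeriv φ (baseCoord ξ) (fiberCoord ξ) ≠ 0 :=
          fun h => hv (by rw [h, smul_zero])
        rw [hu _ _ _ h0 hc]
        have hξ : ξ ∈ K b := ⟨by rw [hbase]; exact hpb, hbd⟩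
        have h1 := hmax b hξ
        have h2 := ha b (Finset.mem_univ _)
        have hp : φ.symm (baseCoord ξ) = p := by rw [hbase, φ.left_inv hps]
        simp only [Set.mem_ofPred_eq, hp] at h1
        exact h1.trans h2
  -- By homogeneity the maximising vector may be replaced by a normalised one, which has coordinates
  -- on P(T_M).
  obtain ⟨p₀, v₀, hv₀, hmax⟩ := hM
  have hφ := IsManifold.chart_mem_maximalAtlas (I := 𝓘(ℂ, EuclideanSpace ℂ (Fin m))) (n := ω) p₀
  have hp₀ := mem_chart_source (EuclideanSpace ℂ (Fin m)) p₀
  obtain ⟨a, ζ, c, hc, hbase, -, rfl⟩ :=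
    exists_tautologicalSection hφ ((chartAt (EuclideanSpace ℂ (Fin m)) p₀).map_source hp₀) v₀ hv₀
  refine ⟨_, hφ, a, ζ, ?_, fun p v hv => ?_⟩
  · change baseCoord ζ ∈ (chartAt (EuclideanSpace ℂ (Fin m)) p₀).target
    rw [hbase]
    exact (chartAt (EuclideanSpace ℂ (Fin m)) p₀).map_source hp₀
  · have h0 : chartSymmDeriv (chartAt (EuclideanSpace ℂ (Fin m)) p₀) (baseCoord ζ)
        (fiberCoord ζ) ≠ 0 := fun h => hv₀ (by rw [h, smul_zero])
    have h1 := hmax p (Set.mem_univ _) v hv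
    rw [hu _ _ _ h0 hc] at h1
    have hp : (chartAt (EuclideanSpace ℂ (Fin m)) p₀).symm (baseCoord ζ) = p₀ := by
      rw [hbase, (chartAt (EuclideanSpace ℂ (Fin m)) p₀).left_inv hp₀]
    rw [hp]
    exact h1

end Maximum

/-! ## The maximum principle -/

section MaximumPrinciple

variable {m n : ℕ} {M : Type*} [TopologicalSpace M] [ChartedSpace (EuclideanSpace ℂ (Fin m)) M]
  {N : Type*} [TopologicalSpace N] [ChartedSpace (EuclideanSpace ℝ (Fin n)) N]
  [IsManifold 𝓘(ℝ, EuclideanSpace ℝ (Fin n)) ∞ N]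
  {g : SmoothRiemannianMetric (n := n) N}
  {ψ : OpenPartialHomeomorph N (EuclideanSpace ℝ (Fin n))}
  {φ : OpenPartialHomeomorph M (EuclideanSpace ℂ (Fin m))} {f : M → N} {a : Fin m}

/-- The tautological section is affine in ζ, and its linear part commutes with i. It is therefore a
family W to which `log_partialEnergy_subharmonic` applies. -/
lemma mapEnergy_tautologicalSection
    (hφ : φ ∈ IsManifold.maximalAtlas 𝓘(ℂ, EuclideanSpace ℂ (Fin m)) ω M)
    (hψ : ψ ∈ IsManifold.maximalAtlas 𝓘(ℝ, EuclideanSpace ℝ (Fin n)) ∞ N)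
    (hf : ContMDiff 𝓘(ℝ, EuclideanSpace ℂ (Fin m)) 𝓘(ℝ, EuclideanSpace ℝ (Fin n)) ∞ f)
    {ζ : EuclideanSpace ℂ (Fin m ⊕ {i : Fin m // i ≠ a})} (hζ : baseCoord ζ ∈ mapDomain φ ψ f) :
    mapEnergy g f (φ.symm (baseCoord ζ)) (chartSymmDeriv φ (baseCoord ζ) (fiberCoord ζ))
      = partialEnergy (metricBilin g ψ) (mulI _) (fun y => ψ (f (φ.symm y))) (baseCoordL a)
        (fiberCoordL a) (EuclideanSpace.single a 1) ζ := by
  rw [mapEnergy_chart hφ hψ hf hζ, fiberCoord_eq]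
  rfl

variable [IsManifold 𝓘(ℂ, EuclideanSpace ℂ (Fin m)) ω M]

namespace TautologicalHermitianMetric

/-- The squared length of the standard local section of the tautological line bundle. -/
abbrev localNormSq (H : TautologicalHermitianMetric (m := m) M)
    (φ : OpenPartialHomeomorph M (EuclideanSpace ℂ (Fin m))) (a : Fin m)
    (ζ : EuclideanSpace ℂ (Fin m ⊕ {i : Fin m // i ≠ a})) : ℝ :=
  tautologicalNormSq H.core _ (tautologicalSection φ (a := a) ζ)

variable (H : TautologicalHermitianMetric (m := m) M)
  {ζ : EuclideanSpace ℂ (Fin m ⊕ {i : Fin m // i ≠ a})}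

lemma contDiffAt_localNormSq
    (hφ : φ ∈ IsManifold.maximalAtlas 𝓘(ℂ, EuclideanSpace ℂ (Fin m)) ω M)
    (hζ : ζ ∈ projChartTarget φ a) : ContDiffAt ℝ ∞ (H.localNormSq φ a) ζ :=
  (H.smooth φ hφ a).contDiffAt ((isOpen_projChartTarget φ a).mem_nhds hζ)

lemma localNormSq_pos
    (hφ : φ ∈ IsManifold.maximalAtlas 𝓘(ℂ, EuclideanSpace ℂ (Fin m)) ω M)
    (hζ : ζ ∈ projChartTarget φ a) : 0 < H.localNormSq φ a ζ := by
  refine tautologicalNormSq_pos H.core _ _ fun h => ?_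
  exact fiberCoord_ne_zero ζ (chartSymmDeriv_injective hφ hζ (h.trans (map_zero _).symm))

end TautologicalHermitianMetric

lemma IsPluriharmonic.eventually_mapEnergy_eq (hf : IsPluriharmonic (m := m) g f)
    (hφ : φ ∈ IsManifold.maximalAtlas 𝓘(ℂ, EuclideanSpace ℂ (Fin m)) ω M)
    (hψ : ψ ∈ IsManifold.maximalAtlas 𝓘(ℝ, EuclideanSpace ℝ (Fin n)) ∞ N)
    {ζ : EuclideanSpace ℂ (Fin m ⊕ {i : Fin m // i ≠ a})} (hζ : baseCoord ζ ∈ mapDomain φ ψ f) :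
    ∀ᶠ ξ in nhds ζ,
      mapEnergy g f (φ.symm (baseCoord ξ)) (chartSymmDeriv φ (baseCoord ξ) (fiberCoord ξ))
      = partialEnergy (metricBilin g ψ) (mulI _) (fun y => ψ (f (φ.symm y))) (baseCoordL a)
        (fiberCoordL a) (EuclideanSpace.single a 1) ξ := by
  filter_upwards [((isOpen_mapDomain hf.smooth.continuous).preimage
    continuous_baseCoord).mem_nhds hζ] with ξ hξ
    using mapEnergy_tautologicalSection hφ hψ hf.smooth hξ

lemma IsPluriharmonic.continuousAt_mapEnergy (hf : IsPluriharmonic (m := m) g f)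
    (hφ : φ ∈ IsManifold.maximalAtlas 𝓘(ℂ, EuclideanSpace ℂ (Fin m)) ω M)
    {ζ : EuclideanSpace ℂ (Fin m ⊕ {i : Fin m // i ≠ a})} (hζ : ζ ∈ projChartTarget φ a) :
    ContinuousAt (fun ξ : EuclideanSpace ℂ (Fin m ⊕ {i : Fin m // i ≠ a}) =>
      mapEnergy g f (φ.symm (baseCoord ξ)) (chartSymmDeriv φ (baseCoord ξ) (fiberCoord ξ))) ζ := by
  have hψ := IsManifold.chart_mem_maximalAtlas (I := 𝓘(ℝ, EuclideanSpace ℝ (Fin n))) (n := ∞)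
    (f (φ.symm (baseCoord ζ)))
  have hζ' : baseCoord ζ ∈ mapDomain φ (chartAt (EuclideanSpace ℝ (Fin n))
    (f (φ.symm (baseCoord ζ)))) f := ⟨hζ, mem_chart_source _ _⟩
  refine ContinuousAt.congr ?_ (Filter.EventuallyEq.symm (hf.eventually_mapEnergy_eq hφ hψ hζ'))
  exact (partialEnergy_contDiffAt (hf.isPluriharmonicOn_chart hφ hψ)
    (isLeviCivitaOn_chart hψ) hζ').continuousAt

/-- The quotient of `|∂f|²` by a metric of positive curvature direction has no positive local
maximum. -/
lemma IsPluriharmonic.not_isLocalMax (hf : IsPluriharmonic (m := m) g f)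
    (hN : NonposSectionalCurvature g) (H : TautologicalHermitianMetric (m := m) M)
    (hφ : φ ∈ IsManifold.maximalAtlas 𝓘(ℂ, EuclideanSpace ℂ (Fin m)) ω M)
    {ζ : EuclideanSpace ℂ (Fin m ⊕ {i : Fin m // i ≠ a})} (hζ : ζ ∈ projChartTarget φ a)
    (hcurv : HasPositiveEigenvalue (chernCurvature (H.localNormSq φ a) ζ))
    (hpos : 0 < mapEnergy g f (φ.symm (baseCoord ζ))
      (chartSymmDeriv φ (baseCoord ζ) (fiberCoord ζ))) :
    ¬ IsLocalMax (fun ξ => mapEnergy g f (φ.symm (baseCoord ξ))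
      (chartSymmDeriv φ (baseCoord ξ) (fiberCoord ξ)) / H.localNormSq φ a ξ) ζ := by
  intro hmax
  have hψ := IsManifold.chart_mem_maximalAtlas (I := 𝓘(ℝ, EuclideanSpace ℝ (Fin n))) (n := ∞)
    (f (φ.symm (baseCoord ζ)))
  have hζ' : baseCoord ζ ∈ mapDomain φ (chartAt (EuclideanSpace ℝ (Fin n))
    (f (φ.symm (baseCoord ζ)))) f := ⟨hζ, mem_chart_source _ _⟩
  generalize chartAt (EuclideanSpace ℝ (Fin n)) (f (φ.symm (baseCoord ζ))) = ψ at hψ hζ'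
  have hF := hf.isPluriharmonicOn_chart hφ hψ
  have hLC := isLeviCivitaOn_chart (g := g) hψ
  have hev := hf.eventually_mapEnergy_eq hφ hψ hζ'
  have hζβ : baseCoordL a ζ ∈ mapDomain φ ψ f := hζ'
  rw [hev.self_of_nhds] at hpos
  set P := partialEnergy (metricBilin g ψ) (mulI _) (fun y => ψ (f (φ.symm y))) (baseCoordL a)
        (fiberCoordL a) (EuclideanSpace.single a 1) with hP
  have hρ := H.contDiffAt_localNormSq hφ hζ
  have hρ0 := H.localNormSq_pos hφ hζ
  have hPs : ContDiffAt ℝ ∞ P ζ := partialEnergy_contDiffAt hF hLC hζβ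
  obtain ⟨v, hv⟩ := hcurv.exists_direction hρ hρ0.ne'
  have hsub : 0 ≤ fderiv ℝ (fderiv ℝ fun ξ => Real.log (P ξ)) ζ v v
      + fderiv ℝ (fderiv ℝ fun ξ => Real.log (P ξ)) ζ (mulI _ v) (mulI _ v) :=
    log_partialEnergy_subharmonic hF hLC
      (fun y hy => curvOp_nonneg_of_nonposSectionalCurvature hN hψ hy) hζβ hpos
      (baseCoordL_mulI v) (fiberCoordL_mulI v)
  have hlP := hPs.log hpos.ne'
  have hlρ := hρ.log hρ0.ne'
  -- Near ζ both terms are positive, so taking logarithms preserves the maximum and turns the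
  -- quotient into a difference.
  have hmax' : IsLocalMax (fun ξ => Real.log (P ξ) - Real.log (H.localNormSq φ a ξ)) ζ := by
    filter_upwards [hmax, hev, hPs.continuousAt.eventually (lt_mem_nhds hpos),
      hρ.continuousAt.eventually (lt_mem_nhds hρ0)] with ξ h1 h2 h3 h4
    rw [← Real.log_div h3.ne' h4.ne', ← Real.log_div hpos.ne' hρ0.ne']
    rw [h2, hev.self_of_nhds] at h1
    exact Real.log_le_log (div_pos h3 h4) h1
  have hsplit : ∀ w, fderiv ℝ (fderiv ℝ fun ξ => Real.log (P ξ)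
        - Real.log (H.localNormSq φ a ξ)) ζ w w
      = fderiv ℝ (fderiv ℝ fun ξ => Real.log (P ξ)) ζ w w
        - fderiv ℝ (fderiv ℝ fun ξ => Real.log (H.localNormSq φ a ξ)) ζ w w := by
    intro w
    have h1 : fderiv ℝ (fun ξ => Real.log (P ξ) - Real.log (H.localNormSq φ a ξ)) =ᶠ[nhds ζ]
        fun ξ => fderiv ℝ (fun ξ => Real.log (P ξ)) ξ
          - fderiv ℝ (fun ξ => Real.log (H.localNormSq φ a ξ)) ξ := by
      filter_upwards [hlP.eventually_differentiableAt, hlρ.eventually_differentiableAt]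
        with ξ h1 h2 using fderiv_fun_sub h1 h2
    rw [h1.fderiv_eq, fderiv_fun_sub hlP.fderiv_infty.differentiableAt_infty
      hlρ.fderiv_infty.differentiableAt_infty]
    rfl
  -- At a maximum the second derivatives along v and iv are non-positive. Their sum, however, is the
  -- nonnegative `hsub` minus the negative `hv`.
  have m1 := hmax'.fderiv_fderiv_nonpos (hlP.sub hlρ) v
  have m2 := hmax'.fderiv_fderiv_nonpos (hlP.sub hlρ) (mulI _ v)
  rw [hsplit] at m1 m2
  linarith

end MaximumPrinciple

end

/-! ### Vanishing of the differential -/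

theorem theorem1p9 {m n : ℕ}
    {M : Type*} [TopologicalSpace M] [ChartedSpace (EuclideanSpace ℂ (Fin m)) M]
    [IsManifold 𝓘(ℂ, EuclideanSpace ℂ (Fin m)) ω M]
    [T2Space M] [CompactSpace M] [ConnectedSpace M]
    {N : Type*} [TopologicalSpace N] [ChartedSpace (EuclideanSpace ℝ (Fin n)) N]
    [IsManifold 𝓘(ℝ, EuclideanSpace ℝ (Fin n)) ∞ N] [T2Space N]
    (g : SmoothRiemannianMetric (n := n) N) (hN : NonposSectionalCurvature g)
    (hM : TautologicalRCPositive (m := m) M)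
    (f : M → N) (hf : IsPluriharmonic (m := m) g f) :
    ∃ q : N, ∀ p : M, f p = q := by
  obtain ⟨H, hH⟩ := hM
  have hne : Nonempty M := inferInstance
  suffices h : ∀ p (v : EuclideanSpace ℂ (Fin m)), realDeriv (n := n) f p v = 0 from
    ⟨f hne.some, fun p => eq_of_realDeriv_eq_zero hf.smooth h p _⟩
  intro p v
  by_cases hv : v = 0
  · rw [hv, map_zero]
  refine realDeriv_eq_zero_of_mapEnergy (g := g) (not_lt.1 fun hpos => ?_)
  have hm : 0 < m := by
    rcases Nat.eq_zero_or_pos m with rfl | h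
    · exact absurd (Subsingleton.elim v 0) hv
    · exact h
  obtain ⟨φ, hφ, a, ζ, hζ, hmax⟩ := exists_max_projTangent
    (fun p v => mapEnergy g f p v / tautologicalNormSq H.core p v) (fun p v c hv hc => by
      have hc' : Complex.normSq c ≠ 0 := (Complex.normSq_pos.2 hc).ne'
      have h1 := mapEnergy_smul (g := g) (f := f) p c v
      have h2 := tautologicalNormSq_smul H.core p v hv hc
      exact (congrArg₂ (· / ·) h1 h2).trans (mul_div_mul_left _ _ hc'))
    (fun φ hφ a ζ hζ => ((hf.continuousAt_mapEnergy hφ hζ).div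
      (H.contDiffAt_localNormSq hφ hζ).continuousAt
      (H.localNormSq_pos hφ hζ).ne').continuousWithinAt) hne hm
  -- The maximum dominates the positive value at (p, v), so the energy is positive at the maximum
  -- point, where its logarithm is taken.
  have hquot : 0 < mapEnergy g f (φ.symm (baseCoord ζ))
      (chartSymmDeriv φ (baseCoord ζ) (fiberCoord ζ)) / H.localNormSq φ a ζ :=
    (div_pos hpos (tautologicalNormSq_pos H.core p v hv)).trans_le (hmax p v hv)
  refine hf.not_isLocalMax hN H hφ hζ (hH φ hφ a ζ hζ)
    ((div_pos_iff_of_pos_right (H.localNormSq_pos hφ hζ)).1 hquot) ?_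
  filter_upwards [(isOpen_projChartTarget φ a).mem_nhds hζ] with ξ hξ
  refine hmax _ _ fun h => ?_
  exact fiberCoord_ne_zero ξ (chartSymmDeriv_injective hφ hξ (h.trans (map_zero _).symm))
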